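/- Let $d\ge 1$, $\mathbb R_+=(0,\infty)$, $\alpha\in(-1,\infty)^d$, $|\alpha|=\alpha_1+\dots+\alpha_d$ and $d\mu_\alpha(x)=\prod_{i=1}^d x_i^{2\alpha_i+1}\,dx$ on $\mathbb R_+^d$. With $L_n^a$ the Laguerre polynomial of degree $n$ and order $a>-1$, put, for $k\in\mathbb N^d$ and $x\in\mathbb R_+^d$, $$\ell_k^\alpha(x)=\prod_{i=1}^d \Big(\frac{2\,\Gamma(k_i+1)}{\Gamma(k_i+\alpha_i+1)}\Big)^{1/2}L_{k_i}^{\alpha_i}(x_i^2)\,e^{-x_i^2/2},\qquad \lambda_k=4|k|+2|\alpha|+2d .$$ Then $\{\ell_k^\alpha\}$ is an orthonormal basis of $L^2(\mathbb R_+^d,\mu_\alpha)$ and $\ell_k^\alpha$ is an eigenfunction, with eigenvalue $\lambda_k$, of the differential operator $-\Delta+\|x\|^2-\sum_{i}\frac{2\alpha_i+1}{x_i}\partial_{x_i}$; let $L$ be its self-adjoint extension whose spectral decomposition is given by the $\ell_k^\alpha$. Let $G_t(x,y)=\sum_{k\in\mathbb N^d} e^{-t\lambda_k}\ell_k^\alpha(x)\ell_k^\alpha(y)$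 for $t>0$, and let $T_0^{\alpha,\ell}=\mathrm{Id}$ and $$T_t^{\alpha,\ell}f(x)=\int_{\mathbb R_+^d}G_t(x,y)f(y)\,d\mu_\alpha(y),\qquad t>0,\ x\in\mathbb R_+^d,\ f\in L^1(\mu_\alpha)+L^\infty(\mu_\alpha).$$ The series and the integrals converge absolutely, and $T_t^{\alpha,\ell}f=e^{-tL}f=\sum_k e^{-t\lambda_k}\langle f,\ell_k^\alpha\rangle\,\ell_k^\alpha$ (in $L^2$) for all $f\in L^2(\mu_\alpha)$ and $t\ge 0$. A symmetric diffusion semigroup on a measure space $(X,\mu)$ is a family $\{T_t\}_{t\ge0}$ of linear operators, $T_0=\mathrm{Id}$, mapping $L^1+L^\infty$ into measurable functions, such that (i) for each $1\le p\le\infty$ every $T_t$ is a contraction on $L^p$ and $\{T_t\}$ is a semigroup there; (ii) each $T_t$ is self-adjoint on $L^2$; (iii) $T_tf\to f$ in $L^2$ as $t\to0^+$ for every $f\in L^2$. It is submarkovian if moreover $T_tf\ge0$ whenever $f\ge0$, and $T_t\mathbf 1\le\mathbf 1$, for all $t$; it is Markovian if moreover $T_tf\ge0$ whenever $f\ge0$,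 and $T_t\mathbf 1=\mathbf 1$, for all $t$. Theorem. For every $d\ge1$ and $\alpha\in(-1,\infty)^d$, $\{T_t^{\alpha,\ell}\}_{t\ge0}$ is a submarkovian, but not Markovian, symmetric diffusion semigroup on $(\mathbb R_+^d,\mu_\alpha)$, and for all $1\le p\le\infty$ and $t>0$, $$\|T_t^{\alpha,\ell}\|_{L^p(\mu_\alpha)\to L^p(\mu_\alpha)}\le(\cosh 2t)^{-(|\alpha|+d)} .$$ Moreover, in dimension $d=1$, for all $\alpha>-1$, $t>0$ and $x>0$, $$T_t^{\alpha,\ell}\mathbf 1(x)=(\cosh 2t)^{-\alpha-1}\exp\Big(-\tfrac12x^2\tanh 2t\Big).$$ -/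

import Mathlib

open MeasureTheory Filter Topology
open scoped ENNReal ComplexOrder

noncomputable section

/-! Symmetric diffusion semigroups on a measure space. Operators act on functions, and all
identities between functions are identities almost everywhere. -/

section Abstract

variable {X : Type*} [MeasurableSpace X] {𝕜 : Type*} [RCLike 𝕜]

/-- Membership in `L¹(μ) + L^∞(μ)`, the common domain of the operators. -/
def MemL1AddLinfty (f : X → 𝕜) (μ : Measure X) : Prop :=
  ∃ g h : X → 𝕜, MemLp g 1 μ ∧ MemLp h ∞ μ ∧ f = g + h

/-- The operator norm `‖S‖_{p → p}` of an operator `S` on `L^p(μ)`: the least constant `C` in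
`[0, ∞]` such that `‖S f‖_p ≤ C ‖f‖_p` for all `f` in `L^p(μ)`. -/
def lpOpNorm (S : (X → 𝕜) → X → 𝕜) (p : ℝ≥0∞) (μ : Measure X) : ℝ≥0∞ :=
  sInf {C : ℝ≥0∞ | ∀ f : X → 𝕜, MemLp f p μ → eLpNorm (S f) p μ ≤ C * eLpNorm f p μ}

/-- `{T t}_{t ≥ 0}` is a symmetric diffusion semigroup on `(X, μ)`, with common domain
`L¹(μ) + L^∞(μ)`. Only the values `T t` for `t ≥ 0` matter. -/
structure IsSymmetricDiffusionSemigroup (T : ℝ → (X → 𝕜) → X → 𝕜) (μ : Measure X) : Prop where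
  /-- `T t f` is measurable. -/
  aestronglyMeasurable : ∀ t, 0 ≤ t → ∀ f, MemL1AddLinfty f μ → AEStronglyMeasurable (T t f) μ
  /-- `T t` acts on classes of functions modulo equality almost everywhere. -/
  congr_ae : ∀ t, 0 ≤ t → ∀ f g, MemL1AddLinfty f μ → MemL1AddLinfty g μ →
    f =ᵐ[μ] g → T t f =ᵐ[μ] T t g
  /-- `T t` is additive. -/
  map_add : ∀ t, 0 ≤ t → ∀ f g, MemL1AddLinfty f μ → MemL1AddLinfty g μ →
    T t (f + g) =ᵐ[μ] T t f + T t g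
  /-- `T t` is homogeneous. -/
  map_smul : ∀ t, 0 ≤ t → ∀ (c : 𝕜) (f), MemL1AddLinfty f μ → T t (c • f) =ᵐ[μ] c • T t f
  /-- `T 0` is the identity. -/
  zero : ∀ f, MemL1AddLinfty f μ → T 0 f =ᵐ[μ] f
  /-- `T t` maps `L^p` into itself, for `1 ≤ p ≤ ∞`. -/
  memLp : ∀ p : ℝ≥0∞, 1 ≤ p → ∀ t, 0 ≤ t → ∀ f, MemLp f p μ → MemLp (T t f) p μ
  /-- `T t` is a contraction on `L^p`, for `1 ≤ p ≤ ∞`. -/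
  contraction : ∀ p : ℝ≥0∞, 1 ≤ p → ∀ t, 0 ≤ t → lpOpNorm (T t) p μ ≤ 1
  /-- The semigroup property on `L^p`, for `1 ≤ p ≤ ∞`. -/
  semigroup : ∀ p : ℝ≥0∞, 1 ≤ p → ∀ s t, 0 ≤ s → 0 ≤ t → ∀ f, MemLp f p μ →
    T (s + t) f =ᵐ[μ] T s (T t f)
  /-- `T t` is self-adjoint on `L²`. -/
  selfAdjoint : ∀ t, 0 ≤ t → ∀ f g, MemLp f 2 μ → MemLp g 2 μ →
    ∫ x, T t f x * star (g x) ∂μ = ∫ x, f x * star (T t g x) ∂μ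
  /-- `T t f → f` in `L²` as `t → 0⁺`, for every `f` in `L²`. -/
  continuous_zero : ∀ f, MemLp f 2 μ →
    Tendsto (fun t => eLpNorm (T t f - f) 2 μ) (𝓝[>] 0) (𝓝 0)

/-- Each `T t` preserves nonnegative functions. -/
def IsPositiveFamily (T : ℝ → (X → 𝕜) → X → 𝕜) (μ : Measure X) : Prop :=
  ∀ t, 0 ≤ t → ∀ f, MemL1AddLinfty f μ → (∀ᵐ x ∂μ, 0 ≤ f x) → ∀ᵐ x ∂μ, 0 ≤ T t f x

/-- A Markovian symmetric diffusion semigroup: positive, and `T t 1 = 1` for all `t`. -/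
structure IsMarkovianSemigroup (T : ℝ → (X → 𝕜) → X → 𝕜) (μ : Measure X) : Prop where
  isSymmetricDiffusionSemigroup : IsSymmetricDiffusionSemigroup T μ
  positive : IsPositiveFamily T μ
  conservative : ∀ t, 0 ≤ t → ∀ᵐ x ∂μ, T t (fun _ => 1) x = 1

/-- A submarkovian symmetric diffusion semigroup: positive, and `T t 1 ≤ 1` for all `t`. -/
structure IsSubmarkovianSemigroup (T : ℝ → (X → 𝕜) → X → 𝕜) (μ : Measure X) : Prop where
  isSymmetricDiffusionSemigroup : IsSymmetricDiffusionSemigroup T μ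
  positive : IsPositiveFamily T μ
  subconservative : ∀ t, 0 ≤ t → ∀ᵐ x ∂μ, T t (fun _ => 1) x ≤ 1

end Abstract

namespace LaguerreConv

/-- The open orthant `ℝ₊^d = (0, ∞)^d`. -/
def orthant (d : ℕ) : Set (Fin d → ℝ) := {x | ∀ i, 0 < x i}

/-- The measure `dμ_α(x) = (∏ i, x_i ^ (2 α_i + 1)) dx` on `ℝ₊^d`, as a measure on `ℝ^d`
concentrated on the orthant. -/
def measure {d : ℕ} (α : Fin d → ℝ) : Measure (Fin d → ℝ) :=
  (volume.restrict (orthant d)).withDensity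
    (fun x => ENNReal.ofReal (∏ i, x i ^ (2 * α i + 1)))

/-- The Laguerre polynomial `L_n^a` of degree `n` and order `a > -1`:
`L_n^a(x) = ∑_{j ≤ n} Γ(n + a + 1) / (Γ(j + a + 1) (n - j)! j!) (-x)^j`. -/
def laguerre (n : ℕ) (a x : ℝ) : ℝ :=
  ∑ j ∈ Finset.range (n + 1),
    Real.Gamma (n + a + 1) / (Real.Gamma (j + a + 1) * (n - j).factorial * j.factorial) * (-x) ^ j

/-- The one-dimensional Laguerre functions of convolution type,
`ℓ_n^a(x) = (2 Γ(n + 1) / Γ(n + a + 1))^{1/2} L_n^a(x²) e^{-x²/2}`. -/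
def ell1 (n : ℕ) (a x : ℝ) : ℝ :=
  √2 * √(Real.Gamma (n + 1) / Real.Gamma (n + a + 1)) * laguerre n a (x ^ 2) *
    Real.exp (-x ^ 2 / 2)

variable {d : ℕ}

/-- The multi-dimensional Laguerre functions of convolution type (tensor products). -/
def ell (α : Fin d → ℝ) (k : Fin d → ℕ) (x : Fin d → ℝ) : ℝ :=
  ∏ i, ell1 (k i) (α i) (x i)

/-- The eigenvalues `4|k| + 2|α| + 2d`. -/
def eigenvalue (α : Fin d → ℝ) (k : Fin d → ℕ) : ℝ :=
  4 * ∑ i, (k i : ℝ) + 2 * ∑ i, α i + 2 * d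

/-- The differential operator
`-Δ + ‖x‖² - ∑ i, ((2 α_i + 1) / x_i) ∂/∂x_i` (with the Euclidean norm). -/
def diffOp (α : Fin d → ℝ) (f : (Fin d → ℝ) → ℝ) (x : Fin d → ℝ) : ℝ :=
  -(∑ i, iteratedDeriv 2 (fun s => f (Function.update x i s)) (x i)) + (∑ i, x i ^ 2) * f x -
    ∑ i, (2 * α i + 1) / x i * deriv (fun s => f (Function.update x i s)) (x i)

/-- The heat kernel `G_t(x, y) = ∑_k e^{-t (4|k| + 2|α| + 2d)} ℓ_k(x) ℓ_k(y)`. -/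
def kernel (α : Fin d → ℝ) (t : ℝ) (x y : Fin d → ℝ) : ℝ :=
  ∑' k : Fin d → ℕ, Real.exp (-t * eigenvalue α k) * (ell α k x * ell α k y)

/-- The Laguerre semigroup of convolution type: `T_0 f = f` and
`T_t f(x) = ∫ G_t(x, y) f(y) dμ_α(y)` for `t > 0`. -/
def semigroup (𝕜 : Type*) [RCLike 𝕜] (α : Fin d → ℝ) (t : ℝ) (f : (Fin d → ℝ) → 𝕜)
    (x : Fin d → ℝ) : 𝕜 :=
  if t = 0 then f x else ∫ y, kernel α t x y • f y ∂(measure α)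

/-- The partial sum, over a finite set `s` of multi-indices, of the spectral series
`∑_k e^{-t (4|k| + 2|α| + 2d)} ⟨f, ℓ_k⟩ ℓ_k` which defines `exp(-tL) f` for `f` in `L²(μ_α)`. -/
def spectralPartialSum {𝕜 : Type*} [RCLike 𝕜] (α : Fin d → ℝ) (t : ℝ) (f : (Fin d → ℝ) → 𝕜)
    (s : Finset (Fin d → ℕ)) (x : Fin d → ℝ) : 𝕜 :=
  ∑ k ∈ s, (Real.exp (-t * eigenvalue α k) * ell α k x) • ∫ y, ell α k y • f y ∂(measure α)

/-- On `L²(μ_α)` the operators `T t`, `t ≥ 0`, are `exp(-tL)`, where `L` is the self-adjoint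
extension of the differential operator `diffOp α` whose spectral decomposition is given by the
`ℓ_k`: these are eigenfunctions of `diffOp α`, they are orthonormal, and the spectral series of
`exp(-tL) f` converges to `T t f` in `L²(μ_α)` for every `f` in `L²(μ_α)` (for `t = 0` and
`T 0 = Id` this is completeness of the system). -/
structure IsHeatSemigroup {𝕜 : Type*} [RCLike 𝕜] (α : Fin d → ℝ)
    (T : ℝ → ((Fin d → ℝ) → 𝕜) → (Fin d → ℝ) → 𝕜) : Prop where
  eigen : ∀ k, ∀ x ∈ orthant d, diffOp α (ell α k) x = eigenvalue α k * ell α k x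
  memLp : ∀ k, MemLp (ell α k) 2 (measure α)
  orthonormal : ∀ j k, ∫ x, ell α j x * ell α k x ∂(measure α) = if j = k then 1 else 0
  zero : ∀ f, MemLp f 2 (measure α) → T 0 f =ᵐ[measure α] f
  hasSum : ∀ t, 0 ≤ t → ∀ f, MemLp f 2 (measure α) →
    Tendsto (fun s => eLpNorm (T t f - spectralPartialSum α t f s) 2 (measure α)) atTop (𝓝 0)

end LaguerreConv

end

/-!
The sums `∑ n, u n * L_n(x)` that occur, with `u n` geometric or with `u n` a Laguerre polynomial in
a second variable times a geometric factor, are computed by one interchange of summations; this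
yields the generating function and the Hille–Hardy formula. The latter writes the one-dimensional
heat kernel in closed form, as a positive factor times a power series with positive coefficients at
a nonnegative argument, so the kernel is nonnegative. Its integral against `1` is computed term by
term from Gaussian moments and equals `cosh(2t)^(-a-1) * exp(-x² tanh(2t) / 2)`. In dimension `d`
the kernel is a product, its mass is at most `cosh(2t)^(-(|α| + d))`, and Schur's test for a
symmetric kernel bounds the norm on every `L^p` by the supremum of the mass. This supremum is `< 1`
for `t > 0`, which excludes conservation of `1`.

The spectral expansion and strong continuity in `L²` follow from completeness of the `ℓ_k`: a
function orthogonal to all of them is, by the generating function at `w = m / (1 + m)`, orthogonal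
to `exp(-‖x‖² / 2) * ∏ i, exp(-x_i²) ^ m_i` for all `m`, and polynomials in the `exp(-x_i²)`
determine finite measures on the orthant by the Stone–Weierstrass theorem.
-/

section Series

variable {ι κ E : Type*} [AddCommMonoid E] [TopologicalSpace E] [ContinuousAdd E] [T3Space E]

theorem hasSum_swap {f : ι → κ → E} (hf : Summable (Function.uncurry f)) {g : ι → E} {h : κ → E}
    {S : E} (hrow : ∀ i, HasSum (f i) (g i)) (hS : HasSum g S)
    (hcol : ∀ j, HasSum (fun i => f i j) (h j)) : HasSum h S := by
  rw [hS.unique (hf.hasSum.prod_fiberwise hrow)]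
  exact ((Equiv.prodComm κ ι).hasSum_iff.2 hf.hasSum).prod_fiberwise hcol

end Series

section PowerSeries

theorem hasSum_choose_mul {R : Type*} [Semiring R] [TopologicalSpace R] (n : ℕ) (c : ℕ → R) :
    HasSum (fun j => (n.choose j : R) * c j) (∑ j ∈ Finset.range (n + 1), (n.choose j : R) * c j) :=
  hasSum_sum_of_ne_finset_zero fun j hj => by
    rw [Nat.choose_eq_zero_of_lt (by simpa using hj), Nat.cast_zero, zero_mul]

theorem hasSum_choose_mul_pow {R : Type*} [CommSemiring R] [TopologicalSpace R] (w h : R) (n : ℕ) :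
    HasSum (fun j => (n.choose j : R) * (w ^ (n - j) * h ^ j)) ((w + h) ^ n) := by
  have hbinom : (w + h) ^ n =
      ∑ j ∈ Finset.range (n + 1), (n.choose j : R) * (w ^ (n - j) * h ^ j) := by
    rw [add_comm w, add_pow]
    exact Finset.sum_congr rfl fun j _ => by ring
  exact hbinom ▸ hasSum_choose_mul n _

theorem hasSum_choose_right_mul_iff {E : Type*} [NormedRing E] (j : ℕ) (u : ℕ → E) (S : E) :
    HasSum (fun n => (n.choose j : E) * u n) S ↔
      HasSum (fun m => ((j + m).choose j : E) * u (j + m)) S := by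
  refine ((add_right_injective j).hasSum_iff fun n hn => ?_).symm
  have hnj : n < j := not_le.1 fun h => hn ⟨n - j, Nat.add_sub_cancel' h⟩
  rw [Nat.choose_eq_zero_of_lt hnj, Nat.cast_zero, zero_mul]

-- The two summations are interchanged; `u'` and `c'` are majorants with a summable double series.
theorem hasSum_mul_sum_choose {u u' c c' v v' : ℕ → ℝ} {S : ℝ} (hu : ∀ n, |u n| ≤ u' n)
    (hc : ∀ j, |c j| ≤ c' j) (hv' : ∀ j, HasSum (fun n => (n.choose j : ℝ) * u' n) (v' j))
    (hS' : Summable fun j => v' j * c' j)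
    (hv : ∀ j, HasSum (fun n => (n.choose j : ℝ) * u n) (v j))
    (hS : HasSum (fun j => v j * c j) S) :
    HasSum (fun n => u n * ∑ j ∈ Finset.range (n + 1), (n.choose j : ℝ) * c j) S := by
  have hu' : ∀ n, 0 ≤ u' n := fun n => (abs_nonneg _).trans (hu n)
  have hc' : ∀ j, 0 ≤ c' j := fun j => (abs_nonneg _).trans (hc j)
  have hmajorant : Summable fun p : ℕ × ℕ => (p.2.choose p.1 : ℝ) * u' p.2 * c' p.1 := by
    refine (summable_prod_of_nonneg fun p => ?_).2
      ⟨fun j => ((hv' j).mul_right (c' j)).summable,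
        hS'.congr fun j => ((hv' j).mul_right (c' j)).tsum_eq.symm⟩
    have := hu' p.2
    have := hc' p.1
    positivity
  refine hasSum_swap (f := fun j n => (n.choose j : ℝ) * u n * c j)
    (.of_norm_bounded hmajorant fun p => ?_) (fun j => (hv j).mul_right (c j)) hS fun n => ?_
  · simp only [Function.uncurry, norm_mul, Real.norm_eq_abs, Nat.abs_cast]
    exact mul_le_mul (mul_le_mul_of_nonneg_left (hu _) (Nat.cast_nonneg _)) (hc _) (abs_nonneg _)
      (mul_nonneg (Nat.cast_nonneg _) (hu' _))
  · exact ((hasSum_choose_mul n c).mul_left (u n)).congr_fun fun j => by ring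

variable {𝕜 : Type*} [RCLike 𝕜]

theorem eq_of_eventually_hasSum_mul_pow {c c' : ℕ → 𝕜} {f : 𝕜 → 𝕜}
    (hc : ∀ᶠ z in 𝓝 0, HasSum (fun n => c n * z ^ n) (f z))
    (hc' : ∀ᶠ z in 𝓝 0, HasSum (fun n => c' n * z ^ n) (f z)) : c = c' := by
  have hasFPowerSeries : ∀ {b : ℕ → 𝕜}, (∀ᶠ z in 𝓝 0, HasSum (fun n => b n * z ^ n) (f z)) →
      HasFPowerSeriesAt f (FormalMultilinearSeries.ofScalars 𝕜 b) 0 := fun hb =>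
    hasFPowerSeriesAt_iff.2 <| hb.mono fun z hz => by
      simpa only [FormalMultilinearSeries.coeff_ofScalars, smul_eq_mul, zero_add, mul_comm]
        using hz
  have := (hasFPowerSeries hc).eq_formalMultilinearSeries (hasFPowerSeries hc')
  ext n
  simpa using congrArg (fun p => FormalMultilinearSeries.coeff p n) this

theorem summable_mul_choose_mul_pow {c : ℕ → 𝕜} {r : ℝ} {f : 𝕜 → 𝕜}
    (hf : ∀ z, ‖z‖ < r → HasSum (fun n => c n * z ^ n) (f z)) {w h : 𝕜} (hwh : ‖w‖ + ‖h‖ < r) :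
    Summable (Function.uncurry fun n j : ℕ =>
      c n * ((n.choose j : 𝕜) * (w ^ (n - j) * h ^ j))) := by
  have hsum : ∀ n, HasSum
      (fun j => ‖c n‖ * ((n.choose j : ℝ) * (‖w‖ ^ (n - j) * ‖h‖ ^ j)))
      (‖c n‖ * (‖w‖ + ‖h‖) ^ n) :=
    fun n => (hasSum_choose_mul_pow ‖w‖ ‖h‖ n).mul_left ‖c n‖
  have hmajorant : Summable fun p : ℕ × ℕ =>
      ‖c p.1‖ * ((p.1.choose p.2 : ℝ) * (‖w‖ ^ (p.1 - p.2) * ‖h‖ ^ p.2)) := by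
    refine (summable_prod_of_nonneg fun p => ?_).2 ⟨fun n => (hsum n).summable, ?_⟩
    · positivity
    · have hnorm : ‖((‖w‖ + ‖h‖ : ℝ) : 𝕜)‖ = ‖w‖ + ‖h‖ := RCLike.norm_of_nonneg (by positivity)
      refine (hf _ (hnorm.trans_lt hwh)).summable.norm.congr fun n => ?_
      rw [norm_mul, norm_pow, hnorm]
      exact (hsum n).tsum_eq.symm
  refine .of_norm_bounded hmajorant fun p => ?_
  simp only [Function.uncurry, norm_mul, norm_pow, RCLike.norm_natCast, le_refl]

theorem hasSum_choose_mul_of_hasSum_mul_pow {c c' : ℕ → 𝕜} {r : ℝ} {f : 𝕜 → 𝕜}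
    (hf : ∀ z, ‖z‖ < r → HasSum (fun n => c n * z ^ n) (f z)) {w : 𝕜} (hw : ‖w‖ < r)
    (hc' : ∀ᶠ h in 𝓝 0, HasSum (fun j => c' j * h ^ j) (f (w + h))) (j : ℕ) :
    HasSum (fun n => (n.choose j : 𝕜) * (w ^ (n - j) * c n)) (c' j) := by
  have hsmall : ∀ᶠ h : 𝕜 in 𝓝 0, ‖w‖ + ‖h‖ < r :=
    (continuous_const.add continuous_norm).continuousAt.eventually_lt_const (by simpa)
  have hsum : ∀ j, Summable fun n => (n.choose j : 𝕜) * (w ^ (n - j) * c n) := fun j => by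
    obtain ⟨h, hwh, hh⟩ := ((hsmall.filter_mono nhdsWithin_le_nhds).and
      (self_mem_nhdsWithin (s := {0}ᶜ))).exists
    refine (((summable_mul_choose_mul_pow hf hwh).prod_symm.prod_factor j).mul_right
      (h ^ j)⁻¹).congr fun n => ?_
    have := pow_ne_zero j hh
    simp only [Prod.swap, Function.uncurry]
    field_simp
  have hcoeff : (fun j => ∑' n, (n.choose j : 𝕜) * (w ^ (n - j) * c n)) = c' := by
    refine eq_of_eventually_hasSum_mul_pow (hsmall.mono fun h hwh => ?_) hc'
    refine hasSum_swap (summable_mul_choose_mul_pow hf hwh)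
      (fun n => (hasSum_choose_mul_pow w h n).mul_left _)
      (hf _ ((norm_add_le w h).trans_lt hwh)) fun j => ?_
    exact ((hsum j).hasSum.mul_right (h ^ j)).congr_fun fun n => by ring
  exact congrFun hcoeff j ▸ (hsum j).hasSum

end PowerSeries

section Gamma

theorem gamma_natCast_add {b : ℝ} (hb : 0 < b) (n : ℕ) :
    Real.Gamma (n + b) = (ascPochhammer ℝ n).eval b * Real.Gamma b := by
  induction n with
  | zero => simp
  | succ n ih =>
    have : ((n + 1 : ℕ) : ℝ) + b = (n + b) + 1 := by push_cast; ring
    rw [this, Real.Gamma_add_one (by positivity), ih, ascPochhammer_succ_eval]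
    ring

theorem hasSum_gamma_mul_pow {b w : ℝ} (hb : 0 < b) (hw : |w| < 1) :
    HasSum (fun m : ℕ => Real.Gamma (m + b) / m.factorial * w ^ m)
      (Real.Gamma b * (1 - w) ^ (-b)) := by
  have binomial := ((Real.one_div_one_sub_rpow_hasFPowerSeriesOnBall_zero b).hasSum
    (y := w) (by simpa [enorm_eq_nnnorm, ← NNReal.coe_lt_coe] using hw)).mul_left (Real.Gamma b)
  rw [zero_add, one_div, ← Real.rpow_neg (by linarith [(abs_lt.1 hw).2])] at binomial
  refine binomial.congr_fun fun m => ?_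
  have hcoeff : Ring.choose (b + m - 1) m = (ascPochhammer ℝ m).eval b / m.factorial := by
    rw [eq_div_iff (by positivity), mul_comm, ← Polynomial.ascPochhammer_smeval_eq_eval,
      ← Ring.factorial_nsmul_multichoose_eq_ascPochhammer, nsmul_eq_mul, Ring.choose]
    ring_nf
  rw [FormalMultilinearSeries.ofScalars_apply_eq, hcoeff, smul_eq_mul, gamma_natCast_add hb]
  ring

end Gamma

namespace LaguerreConv

section Laguerre

variable {a : ℝ}

theorem gamma_pos (ha : -1 < a) (n : ℕ) : 0 < Real.Gamma (n + a + 1) :=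
  Real.Gamma_pos_of_pos (by linarith [n.cast_nonneg (α := ℝ)])

theorem laguerre_eq_gamma_mul_sum_choose (n : ℕ) (a x : ℝ) :
    laguerre n a x = Real.Gamma (n + a + 1) / n.factorial *
      ∑ j ∈ Finset.range (n + 1), (n.choose j : ℝ) * ((-x) ^ j / Real.Gamma (j + a + 1)) := by
  rw [laguerre, Finset.mul_sum]
  refine Finset.sum_congr rfl fun j hj => ?_
  rw [Nat.cast_choose ℝ (Finset.mem_range_succ_iff.1 hj)]
  field_simp

theorem abs_laguerre_le (ha : -1 < a) (n : ℕ) (x : ℝ) : |laguerre n a x| ≤ laguerre n a (-|x|) := by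
  refine (Finset.abs_sum_le_sum_abs _ _).trans_eq (Finset.sum_congr rfl fun j _ => ?_)
  have := gamma_pos ha n
  have := gamma_pos ha j
  rw [abs_mul, abs_pow, abs_neg, neg_neg, abs_of_pos (by positivity)]

theorem hasSum_choose_mul_gamma_mul_pow (ha : -1 < a) {w : ℝ} (hw : |w| < 1) (j : ℕ) :
    HasSum (fun n : ℕ => (n.choose j : ℝ) * (Real.Gamma (n + a + 1) / n.factorial * w ^ n))
      (Real.Gamma (j + a + 1) / j.factorial * w ^ j * (1 - w) ^ (-(j + a + 1))) := by
  have hj : 0 < (j : ℝ) + a + 1 := by linarith [j.cast_nonneg (α := ℝ)]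
  refine (hasSum_choose_right_mul_iff j _ _).2 ?_
  have hshift := (hasSum_gamma_mul_pow hj hw).mul_left (w ^ j / j.factorial)
  convert! hshift using 1
  · ext m
    have hcast : ((j + m : ℕ) : ℝ) + a + 1 = m + (j + a + 1) := by push_cast; ring
    rw [Nat.cast_choose ℝ (Nat.le_add_right j m), Nat.add_sub_cancel_left, hcast, pow_add]
    field_simp
  · ring

theorem summable_pow_div_gamma (ha : -1 < a) (z : ℝ) :
    Summable fun m : ℕ => z ^ m / Real.Gamma (m + a + 1) := by
  rcases eq_or_ne z 0 with rfl | hz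
  · exact summable_of_ne_finset_zero (s := {0}) fun m hm => by
      rw [zero_pow (by simpa using hm), zero_div]
  refine summable_of_ratio_test_tendsto_lt_one zero_lt_one
    (Eventually.of_forall fun m => div_ne_zero (pow_ne_zero _ hz) (gamma_pos ha m).ne') ?_
  have hlim : Tendsto (fun m : ℕ => |z| / ((m : ℝ) + (a + 1))) atTop (𝓝 0) :=
    tendsto_const_nhds.div_atTop
      (tendsto_atTop_add_const_right _ _ tendsto_natCast_atTop_atTop)
  refine hlim.congr fun m => ?_
  have hm : 0 < (m : ℝ) + a + 1 := by linarith [m.cast_nonneg (α := ℝ)]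
  have hcast : ((m + 1 : ℕ) : ℝ) + a + 1 = (m + a + 1) + 1 := by push_cast; ring
  have := gamma_pos ha m
  rw [hcast, Real.Gamma_add_one hm.ne', ← norm_div, pow_succ, ← add_assoc]
  have hratio : z ^ m * z / ((m + a + 1) * Real.Gamma (m + a + 1)) /
      (z ^ m / Real.Gamma (m + a + 1)) = z / (m + a + 1) := by
    field_simp
  rw [hratio, norm_div, Real.norm_eq_abs, Real.norm_of_nonneg hm.le]

theorem hasSum_laguerre_mul_pow (ha : -1 < a) {w : ℝ} (hw : |w| < 1) (x : ℝ) :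
    HasSum (fun n => laguerre n a x * w ^ n)
      ((1 - w) ^ (-a - 1) * Real.exp (-x * w / (1 - w))) := by
  have hexp : ∀ x w : ℝ, |w| < 1 → HasSum
      (fun j : ℕ => Real.Gamma (j + a + 1) / j.factorial * w ^ j * (1 - w) ^ (-(j + a + 1)) *
        ((-x) ^ j / Real.Gamma (j + a + 1)))
      ((1 - w) ^ (-a - 1) * Real.exp (-x * w / (1 - w))) := fun x w hw => by
    have hexpSeries := (NormedSpace.expSeries_div_hasSum_exp (-x * w / (1 - w))).mul_left
      ((1 - w) ^ (-a - 1))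
    rw [← Real.exp_eq_exp_ℝ] at hexpSeries
    refine hexpSeries.congr_fun fun j => ?_
    have hj : -((j : ℝ) + a + 1) = (-a - 1) - j := by ring
    rw [hj, Real.rpow_sub (by linarith [(abs_lt.1 hw).2]), Real.rpow_natCast,
      div_pow, mul_pow]
    have := (gamma_pos ha j).ne'
    field_simp
  have hw' : |(|w|)| < 1 := by rwa [abs_abs]
  refine (hasSum_mul_sum_choose
    (u := fun n => Real.Gamma (n + a + 1) / n.factorial * w ^ n)
    (u' := fun n => Real.Gamma (n + a + 1) / n.factorial * |w| ^ n)
    (c := fun j => (-x) ^ j / Real.Gamma (j + a + 1))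
    (c' := fun j => (-(-|x|)) ^ j / Real.Gamma (j + a + 1))
    (fun n => ?_) (fun j => ?_) (hasSum_choose_mul_gamma_mul_pow ha hw') (hexp _ _ hw').summable
    (hasSum_choose_mul_gamma_mul_pow ha hw) (hexp x w hw)).congr_fun fun n => ?_
  · have := gamma_pos ha n
    rw [abs_mul, abs_pow, abs_of_pos (by positivity)]
  · rw [abs_div, abs_pow, abs_neg, neg_neg, abs_of_pos (gamma_pos ha j)]
  · rw [laguerre_eq_gamma_mul_sum_choose]; ring

theorem hasSum_choose_mul_laguerre (ha : -1 < a) {w : ℝ} (hw : |w| < 1) (x : ℝ) (j : ℕ) :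
    HasSum (fun n => (n.choose j : ℝ) * (w ^ (n - j) * laguerre n a x))
      ((1 - w) ^ (-a - 1) * Real.exp (-x * w / (1 - w)) *
        (laguerre j a (x / (1 - w)) / (1 - w) ^ j)) := by
  have hw1 : 0 < 1 - w := by linarith [(abs_lt.1 hw).2]
  refine hasSum_choose_mul_of_hasSum_mul_pow (r := 1)
    (c' := fun j => (1 - w) ^ (-a - 1) * Real.exp (-x * w / (1 - w)) *
      (laguerre j a (x / (1 - w)) / (1 - w) ^ j))
    (fun z hz => hasSum_laguerre_mul_pow ha hz x) hw ?_ j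
  have hsmall : ∀ᶠ h in 𝓝 0, |h / (1 - w)| < 1 :=
    (continuous_abs.comp (continuous_id.div_const _)).continuousAt.eventually_lt_const (by simp)
  filter_upwards [hsmall] with h hh
  have hratio : 0 < 1 - h / (1 - w) := by linarith [(abs_lt.1 hh).2]
  have hfactor : 1 - (w + h) = (1 - w) * (1 - h / (1 - w)) := by field_simp; ring
  have hexponent : -x * (w + h) / (1 - (w + h)) = -x * w / (1 - w) +
      -(x / (1 - w)) * (h / (1 - w)) / (1 - h / (1 - w)) := by
    have : 1 - w - h ≠ 0 := by rw [sub_sub, hfactor]; positivity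
    rw [hfactor]
    field_simp
    ring
  have hgen := (hasSum_laguerre_mul_pow ha hh (x / (1 - w))).mul_left
    ((1 - w) ^ (-a - 1) * Real.exp (-x * w / (1 - w)))
  rw [hexponent, Real.exp_add, hfactor, Real.mul_rpow hw1.le hratio.le]
  convert! hgen using 1
  · ext j
    rw [div_pow]
    field_simp
  · ring

/-- The entire function `∑_m z^m / (m! Γ(m + a + 1))`, which is `z^(-a/2) I_a(2√z)` in terms of the
modified Bessel function `I_a`; unlike `I_a` it is regular at `0`. -/
noncomputable def besselSeries (a z : ℝ) : ℝ :=
  ∑' m : ℕ, z ^ m / (m.factorial * Real.Gamma (m + a + 1))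

theorem hasSum_besselSeries (ha : -1 < a) (z : ℝ) :
    HasSum (fun m : ℕ => z ^ m / (m.factorial * Real.Gamma (m + a + 1))) (besselSeries a z) := by
  refine (Summable.of_norm_bounded (summable_pow_div_gamma ha |z|) fun m => ?_).hasSum
  have := gamma_pos ha m
  rw [norm_div, norm_pow, Real.norm_eq_abs, Real.norm_of_nonneg (by positivity)]
  gcongr
  exact le_mul_of_one_le_left this.le (by exact_mod_cast m.factorial_pos)

theorem hasSum_choose_mul_pow_div_factorial (s : ℝ) (j : ℕ) :
    HasSum (fun n => (n.choose j : ℝ) * (s ^ n / n.factorial))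
      (Real.exp s * (s ^ j / j.factorial)) := by
  refine (hasSum_choose_right_mul_iff j _ _).2 ?_
  have hexp := NormedSpace.expSeries_div_hasSum_exp s
  rw [← Real.exp_eq_exp_ℝ] at hexp
  refine (hexp.mul_right (s ^ j / j.factorial)).congr_fun fun m => ?_
  rw [Nat.cast_choose ℝ (Nat.le_add_right j m), Nat.add_sub_cancel_left, pow_add]
  field_simp

theorem hasSum_laguerre_mul_pow_div_gamma (ha : -1 < a) (x s : ℝ) :
    HasSum (fun n : ℕ => laguerre n a x * (s ^ n / Real.Gamma (n + a + 1)))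
      (Real.exp s * besselSeries a (-x * s)) := by
  have hbessel : ∀ x s : ℝ, HasSum
      (fun j : ℕ => Real.exp s * (s ^ j / j.factorial) * ((-x) ^ j / Real.Gamma (j + a + 1)))
      (Real.exp s * besselSeries a (-x * s)) := fun x s =>
    ((hasSum_besselSeries ha (-x * s)).mul_left (Real.exp s)).congr_fun fun j => by
      rw [mul_pow]; field_simp
  refine (hasSum_mul_sum_choose
    (u := fun n => s ^ n / n.factorial) (u' := fun n => |s| ^ n / n.factorial)
    (c := fun j => (-x) ^ j / Real.Gamma (j + a + 1))
    (c' := fun j => (-(-|x|)) ^ j / Real.Gamma (j + a + 1))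
    (fun n => ?_) (fun j => ?_) (hasSum_choose_mul_pow_div_factorial |s|)
    (hbessel _ _).summable (hasSum_choose_mul_pow_div_factorial s)
    (hbessel x s)).congr_fun fun n => ?_
  · rw [abs_div, abs_pow, Nat.abs_cast]
  · rw [abs_div, abs_pow, abs_neg, neg_neg, abs_of_pos (gamma_pos ha j)]
  · have := gamma_pos ha n
    rw [laguerre_eq_gamma_mul_sum_choose]
    field_simp

theorem hasSum_choose_mul_laguerre_mul_pow (ha : -1 < a) {w : ℝ} (hw : |w| < 1) (x : ℝ) (j : ℕ) :
    HasSum (fun n => (n.choose j : ℝ) * (laguerre n a x * w ^ n))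
      ((1 - w) ^ (-a - 1) * Real.exp (-x * w / (1 - w)) *
        (laguerre j a (x / (1 - w)) * (w / (1 - w)) ^ j)) := by
  refine (hasSum_choose_right_mul_iff j _ _).2 ?_
  have hshift := ((hasSum_choose_right_mul_iff j _ _).1
    (hasSum_choose_mul_laguerre ha hw x j)).mul_left (w ^ j)
  convert! hshift using 1
  · ext m
    rw [Nat.add_sub_cancel_left, pow_add]
    ring
  · rw [div_pow]
    ring

theorem hasSum_hille_hardy (ha : -1 < a) {w : ℝ} (hw : |w| < 1) (x y : ℝ) :
    HasSum (fun n : ℕ =>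
        n.factorial / Real.Gamma (n + a + 1) * (laguerre n a x * laguerre n a y) * w ^ n)
      ((1 - w) ^ (-a - 1) * Real.exp (-(x + y) * w / (1 - w)) *
        besselSeries a (x * y * w / (1 - w) ^ 2)) := by
  have hbessel : ∀ (x y w : ℝ), |w| < 1 → HasSum
      (fun j : ℕ => (1 - w) ^ (-a - 1) * Real.exp (-x * w / (1 - w)) *
        (laguerre j a (x / (1 - w)) * (w / (1 - w)) ^ j) * ((-y) ^ j / Real.Gamma (j + a + 1)))
      ((1 - w) ^ (-a - 1) * Real.exp (-(x + y) * w / (1 - w)) *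
        besselSeries a (x * y * w / (1 - w) ^ 2)) := fun x y w hw => by
    have hbessel := (hasSum_laguerre_mul_pow_div_gamma ha (x / (1 - w))
      (-y * w / (1 - w))).mul_left
      ((1 - w) ^ (-a - 1) * Real.exp (-x * w / (1 - w)))
    have hw1 : 1 - w ≠ 0 := by linarith [(abs_lt.1 hw).2]
    have hexponent : -(x + y) * w / (1 - w) = -x * w / (1 - w) + -y * w / (1 - w) := by ring
    have hargument : -(x / (1 - w)) * (-y * w / (1 - w)) = x * y * w / (1 - w) ^ 2 := by
      field_simp
    rw [hargument] at hbessel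
    rw [hexponent, Real.exp_add]
    convert! hbessel using 1
    · ext j
      rw [mul_div_assoc (-y) w, mul_pow]
      ring
    · ring
  have hw' : |(|w|)| < 1 := by rwa [abs_abs]
  refine (hasSum_mul_sum_choose
    (u := fun n => laguerre n a x * w ^ n) (u' := fun n => laguerre n a (-|x|) * |w| ^ n)
    (c := fun j => (-y) ^ j / Real.Gamma (j + a + 1))
    (c' := fun j => (-(-|y|)) ^ j / Real.Gamma (j + a + 1))
    (fun n => ?_) (fun j => ?_) (hasSum_choose_mul_laguerre_mul_pow ha hw' _)
    (hbessel _ _ _ hw').summable (hasSum_choose_mul_laguerre_mul_pow ha hw x)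
    (hbessel x y w hw)).congr_fun fun n => ?_
  · rw [abs_mul, abs_pow]
    exact mul_le_mul_of_nonneg_right (abs_laguerre_le ha n x) (by positivity)
  · rw [abs_div, abs_pow, abs_neg, neg_neg, abs_of_pos (gamma_pos ha j)]
  · have := gamma_pos ha n
    rw [laguerre_eq_gamma_mul_sum_choose n a y]
    field_simp

end Laguerre

end LaguerreConv

section ProductDensity

theorem lintegral_fin_prod_eq_prod {n : ℕ} {E : Fin n → Type*} {mE : ∀ i, MeasurableSpace (E i)}
    {μ : ∀ i, Measure (E i)} [∀ i, SigmaFinite (μ i)] {f : ∀ i, E i → ℝ≥0∞}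
    (hf : ∀ i, Measurable (f i)) :
    ∫⁻ x, ∏ i, f i (x i) ∂Measure.pi μ = ∏ i, ∫⁻ x, f i x ∂μ i := by
  induction n with
  | zero => simp
  | succ n ih =>
    have hprod : Measurable fun x : ∀ i : Fin n, E i.succ => ∏ i, f i.succ (x i) :=
      Finset.measurable_prod _ fun i _ => (hf _).comp (measurable_pi_apply i)
    rw [Fin.prod_univ_succ, ← ih fun i => hf i.succ,
      ← lintegral_prod_mul (hf 0).aemeasurable hprod.aemeasurable,
      ← ((measurePreserving_piFinSuccAbove μ 0).symm).lintegral_comp_emb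
        (MeasurableEquiv.measurableEmbedding _)]
    simp only [Fin.prod_univ_succ]
    rfl

theorem withDensity_prod_eq_pi {n : ℕ} {E : Fin n → Type*} {mE : ∀ i, MeasurableSpace (E i)}
    {μ : ∀ i, Measure (E i)} [∀ i, SigmaFinite (μ i)] {f : ∀ i, E i → ℝ≥0∞}
    [∀ i, SigmaFinite ((μ i).withDensity (f i))] (hf : ∀ i, Measurable (f i)) :
    (Measure.pi μ).withDensity (fun x => ∏ i, f i (x i)) =
      Measure.pi fun i => (μ i).withDensity (f i) := by
  refine (Measure.pi_eq fun s hs => ?_).symm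
  rw [withDensity_apply _ (.univ_pi hs), Measure.restrict_pi_pi, lintegral_fin_prod_eq_prod hf]
  exact Finset.prod_congr rfl fun i _ => (withDensity_apply _ (hs i)).symm

end ProductDensity

namespace LaguerreConv

/-- The measure `x ^ (2 a + 1) dx` on `(0, ∞)`, as a measure on `ℝ`; `measure α` is the product of
the measures `powerMeasure (α i)`. -/
noncomputable def powerMeasure (a : ℝ) : Measure ℝ :=
  (volume.restrict (Set.Ioi 0)).withDensity fun x => ENNReal.ofReal (x ^ (2 * a + 1))

section OneDim

variable {a : ℝ}

theorem measurable_ofReal_rpow (b : ℝ) : Measurable fun x : ℝ => ENNReal.ofReal (x ^ b) :=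
  (measurable_id.pow_const b).ennreal_ofReal

noncomputable instance (a : ℝ) : SigmaFinite (powerMeasure a) := by
  unfold powerMeasure
  infer_instance

theorem ae_powerMeasure_pos (a : ℝ) : ∀ᵐ x ∂powerMeasure a, 0 < x :=
  (withDensity_absolutelyContinuous _ _).ae_le (ae_restrict_mem measurableSet_Ioi)

theorem rpow_smul_ae_eq (b : ℝ) (f : ℝ → ℝ) :
    (fun x => (ENNReal.ofReal (x ^ b)).toReal • f x) =ᵐ[volume.restrict (Set.Ioi 0)]
      fun x => x ^ b * f x := by
  filter_upwards [ae_restrict_mem measurableSet_Ioi] with x hx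
  rw [ENNReal.toReal_ofReal (Real.rpow_nonneg (le_of_lt hx) _), smul_eq_mul]

theorem integral_powerMeasure (a : ℝ) (f : ℝ → ℝ) :
    ∫ x, f x ∂powerMeasure a = ∫ x in Set.Ioi 0, x ^ (2 * a + 1) * f x := by
  rw [powerMeasure, integral_withDensity_eq_integral_toReal_smul (measurable_ofReal_rpow _)
    (.of_forall fun _ => ENNReal.ofReal_lt_top), integral_congr_ae (rpow_smul_ae_eq _ f)]

theorem integral_sq_pow_mul_exp (ha : -1 < a) {c : ℝ} (hc : 0 < c) (p : ℕ) :
    ∫ x, (x ^ 2) ^ p * Real.exp (-c * x ^ 2) ∂powerMeasure a =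
      Real.Gamma (p + a + 1) / 2 * c ^ (-(p + a + 1)) := by
  have hmoment := integral_rpow_mul_exp_neg_mul_rpow (p := 2) (q := 2 * (p + a) + 1) two_pos
    (by linarith [p.cast_nonneg (α := ℝ)]) hc
  rw [neg_div, show (2 * (p + a) + 1 + 1) / 2 = p + a + 1 by ring] at hmoment
  rw [integral_powerMeasure]
  calc ∫ x in Set.Ioi (0 : ℝ), x ^ (2 * a + 1) * ((x ^ 2) ^ p * Real.exp (-c * x ^ 2))
      = ∫ x in Set.Ioi (0 : ℝ), x ^ (2 * (p + a) + 1) * Real.exp (-c * x ^ (2 : ℝ)) := by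
        refine setIntegral_congr_fun measurableSet_Ioi fun x hx => ?_
        rw [← mul_assoc, ← pow_mul, ← Real.rpow_natCast, ← Real.rpow_add hx, Real.rpow_two]
        congr 2
        push_cast
        ring
    _ = Real.Gamma (p + a + 1) / 2 * c ^ (-(p + a + 1)) := by rw [hmoment]; ring

theorem integrable_sq_pow_mul_exp (ha : -1 < a) {c : ℝ} (hc : 0 < c) (p : ℕ) :
    Integrable (fun x : ℝ => (x ^ 2) ^ p * Real.exp (-c * x ^ 2)) (powerMeasure a) := by
  have := gamma_pos ha p
  refine .of_integral_ne_zero ?_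
  rw [integral_sq_pow_mul_exp ha hc]
  positivity

end OneDim

theorem measure_eq_pi {d : ℕ} (α : Fin d → ℝ) :
    measure α = Measure.pi fun i => powerMeasure (α i) := by
  have horthant : orthant d = Set.univ.pi fun _ => Set.Ioi 0 := by
    ext x
    simp [orthant]
  have : ∀ i, SigmaFinite ((volume.restrict (Set.Ioi 0)).withDensity
      fun x : ℝ => ENNReal.ofReal (x ^ (2 * α i + 1))) := fun i => inferInstance
  unfold measure powerMeasure
  rw [horthant, volume_pi, Measure.restrict_pi_pi,
    ← withDensity_prod_eq_pi fun i => measurable_ofReal_rpow _]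
  refine withDensity_congr_ae ?_
  rw [← Measure.restrict_pi_pi]
  filter_upwards [ae_restrict_mem (.univ_pi fun _ => measurableSet_Ioi)] with x hx
  exact ENNReal.ofReal_prod_of_nonneg fun i _ => Real.rpow_nonneg (le_of_lt (hx i trivial)) _

section MultiDim

variable {d : ℕ} {α : Fin d → ℝ}

noncomputable instance (α : Fin d → ℝ) : SigmaFinite (measure α) :=
  measure_eq_pi α ▸ inferInstance

theorem ae_mem_orthant (α : Fin d → ℝ) : ∀ᵐ x ∂measure α, x ∈ orthant d := by
  rw [measure_eq_pi]
  exact ae_all_iff.2 fun i => Measure.tendsto_eval_ae_ae.eventually (ae_powerMeasure_pos (α i))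

end MultiDim

section Orthogonality

variable {a : ℝ}

-- The left-hand side is `(-1) ^ n` times the `n`-th finite difference of a monic polynomial of
-- degree `j`.
theorem sum_choose_mul_gamma_div_gamma (ha : -1 < a) {n j : ℕ} (hjn : j ≤ n) :
    ∑ i ∈ Finset.range (n + 1), (n.choose i : ℝ) *
        ((-1) ^ i * (Real.Gamma ((i + j : ℕ) + a + 1) / Real.Gamma (i + a + 1))) =
      if j = n then (-1 : ℝ) ^ n * n.factorial else 0 := by
  set P := ascPochhammer ℝ j
  have hdeg : P.natDegree = j := ascPochhammer_natDegree ℝ j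
  have hdiff : (fwdDiff (1 : ℝ))^[n] P.eval (a + 1) = if j = n then (n.factorial : ℝ) else 0 := by
    split_ifs with h
    · have hfactorial := P.fwdDiff_iter_degree_eq_factorial
      rw [hdeg, h, (monic_ascPochhammer ℝ j).leadingCoeff, one_smul] at hfactorial
      rw [hfactorial, Pi.natCast_apply]
    · rw [Polynomial.fwdDiff_iter_eq_zero_of_degree_lt (by omega), Pi.zero_apply]
  suffices h : ∀ i ∈ Finset.range (n + 1), (n.choose i : ℝ) *
      ((-1) ^ i * (Real.Gamma ((i + j : ℕ) + a + 1) / Real.Gamma (i + a + 1))) =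
      (-1) ^ n * (((-1 : ℤ) ^ (n - i) * n.choose i) • P.eval (a + 1 + i • (1 : ℝ))) by
    rw [Finset.sum_congr rfl h, ← Finset.mul_sum, ← fwdDiff_iter_eq_sum_shift 1 P.eval, hdiff,
      mul_ite, mul_zero]
  intro i hi
  have hgamma := gamma_pos ha i
  have hshift : Real.Gamma ((i + j : ℕ) + a + 1) = P.eval (i + a + 1) * Real.Gamma (i + a + 1) := by
    rw [← gamma_natCast_add (by linarith [i.cast_nonneg (α := ℝ)])]
    push_cast
    ring_nf
  have hsign : (-1 : ℝ) ^ n * (-1) ^ (n - i) = (-1) ^ i := by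
    rw [← pow_add, show n + (n - i) = i + 2 * (n - i) by have := Finset.mem_range.1 hi; omega,
      pow_add, (even_two_mul _).neg_one_pow, mul_one]
  rw [hshift, mul_div_cancel_right₀ _ hgamma.ne', nsmul_one, zsmul_eq_mul, ← hsign]
  push_cast
  ring_nf

theorem sq_pow_mul_laguerre_mul_exp (n j : ℕ) (a x : ℝ) :
    (x ^ 2) ^ j * laguerre n a (x ^ 2) * Real.exp (-x ^ 2) =
      Real.Gamma (n + a + 1) / n.factorial * ∑ i ∈ Finset.range (n + 1),
        (n.choose i : ℝ) * ((-1) ^ i / Real.Gamma (i + a + 1)) *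
          ((x ^ 2) ^ (i + j) * Real.exp (-1 * x ^ 2)) := by
  rw [laguerre_eq_gamma_mul_sum_choose, mul_left_comm, mul_assoc, Finset.mul_sum, Finset.sum_mul]
  congr 1
  refine Finset.sum_congr rfl fun i _ => ?_
  rw [neg_pow (x ^ 2), neg_one_mul]
  ring

theorem integrable_sq_pow_mul_laguerre_mul_exp (ha : -1 < a) (n j : ℕ) :
    Integrable (fun x : ℝ => (x ^ 2) ^ j * laguerre n a (x ^ 2) * Real.exp (-x ^ 2))
      (powerMeasure a) := by
  simp only [sq_pow_mul_laguerre_mul_exp]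
  exact (integrable_finsetSum _ fun i _ =>
    (integrable_sq_pow_mul_exp ha one_pos _).const_mul _).const_mul _

theorem integral_sq_pow_mul_laguerre_mul_exp (ha : -1 < a) {n j : ℕ} (hjn : j ≤ n) :
    ∫ x, (x ^ 2) ^ j * laguerre n a (x ^ 2) * Real.exp (-x ^ 2) ∂powerMeasure a =
      if j = n then (-1) ^ n * Real.Gamma (n + a + 1) / 2 else 0 := by
  have hterm : ∀ i : ℕ, (n.choose i : ℝ) * ((-1) ^ i / Real.Gamma (i + a + 1)) *
      (Real.Gamma ((i + j : ℕ) + a + 1) / 2 * 1 ^ (-(((i + j : ℕ) : ℝ) + a + 1))) =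
      (n.choose i : ℝ) *
        ((-1) ^ i * (Real.Gamma ((i + j : ℕ) + a + 1) / Real.Gamma (i + a + 1))) / 2 := fun i => by
    rw [Real.one_rpow]
    ring
  simp only [sq_pow_mul_laguerre_mul_exp]
  rw [integral_const_mul, integral_finsetSum _ fun i _ =>
    (integrable_sq_pow_mul_exp ha one_pos _).const_mul _]
  simp only [integral_const_mul, integral_sq_pow_mul_exp ha one_pos, hterm]
  rw [← Finset.sum_div, sum_choose_mul_gamma_div_gamma ha hjn]
  split_ifs
  · field_simp
  · simp

theorem laguerre_mul_laguerre_mul_exp (m n : ℕ) (a x : ℝ) :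
    laguerre m a (x ^ 2) * laguerre n a (x ^ 2) * Real.exp (-x ^ 2) =
      Real.Gamma (m + a + 1) / m.factorial * ∑ j ∈ Finset.range (m + 1),
        (m.choose j : ℝ) * ((-1) ^ j / Real.Gamma (j + a + 1)) *
          ((x ^ 2) ^ j * laguerre n a (x ^ 2) * Real.exp (-x ^ 2)) := by
  rw [laguerre_eq_gamma_mul_sum_choose m, mul_assoc, mul_assoc, Finset.sum_mul]
  congr 1
  refine Finset.sum_congr rfl fun j _ => ?_
  rw [neg_pow (x ^ 2)]
  ring

theorem integrable_laguerre_mul_laguerre_mul_exp (ha : -1 < a) (m n : ℕ) :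
    Integrable (fun x : ℝ => laguerre m a (x ^ 2) * laguerre n a (x ^ 2) * Real.exp (-x ^ 2))
      (powerMeasure a) := by
  simp only [laguerre_mul_laguerre_mul_exp]
  exact (integrable_finsetSum _ fun j _ =>
    (integrable_sq_pow_mul_laguerre_mul_exp ha n j).const_mul _).const_mul _

theorem integral_laguerre_mul_laguerre_mul_exp (ha : -1 < a) (m n : ℕ) :
    ∫ x, laguerre m a (x ^ 2) * laguerre n a (x ^ 2) * Real.exp (-x ^ 2) ∂powerMeasure a =
      if m = n then Real.Gamma (n + a + 1) / (2 * n.factorial) else 0 := by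
  wlog hmn : m ≤ n generalizing m n
  · simp only [mul_comm (laguerre m a _), this n m (le_of_not_ge hmn), eq_comm (a := n)]
    split_ifs with h
    · rw [h]
    · rfl
  simp only [laguerre_mul_laguerre_mul_exp m n]
  rw [integral_const_mul, integral_finsetSum _ fun j _ =>
    (integrable_sq_pow_mul_laguerre_mul_exp ha n j).const_mul _]
  simp only [integral_const_mul]
  have hmoment : ∀ j ∈ Finset.range (m + 1), ∫ x, (x ^ 2) ^ j * laguerre n a (x ^ 2) *
      Real.exp (-x ^ 2) ∂powerMeasure a =
      if j = n then (-1) ^ n * Real.Gamma (n + a + 1) / 2 else 0 := fun j hj =>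
    integral_sq_pow_mul_laguerre_mul_exp ha ((Finset.mem_range_succ_iff.1 hj).trans hmn)
  rw [Finset.sum_congr rfl fun j hj => by rw [hmoment j hj]]
  simp only [mul_ite, mul_zero, Finset.sum_ite_eq', Finset.mem_range_succ_iff]
  rcases hmn.eq_or_lt with rfl | hlt
  · have := gamma_pos ha m
    rw [if_pos le_rfl, if_pos rfl, Nat.choose_self]
    field_simp
    rw [Nat.cast_one, one_mul, ← pow_mul, (even_two.mul_left m).neg_one_pow]
  · rw [if_neg hlt.not_ge, if_neg hlt.ne]

/-- The factor which normalises `ell1 n a` in `L²`. -/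
noncomputable def normConst (n : ℕ) (a : ℝ) : ℝ :=
  √2 * √(Real.Gamma (n + 1) / Real.Gamma (n + a + 1))

theorem normConst_pos (ha : -1 < a) (n : ℕ) : 0 < normConst n a := by
  have := gamma_pos ha n
  have : 0 < Real.Gamma (n + 1) := Real.Gamma_pos_of_pos (by positivity)
  unfold normConst
  positivity

theorem normConst_mul_self (ha : -1 < a) (n : ℕ) :
    normConst n a * normConst n a = 2 * (n.factorial / Real.Gamma (n + a + 1)) := by
  have := gamma_pos ha n
  rw [normConst, Real.Gamma_nat_eq_factorial, mul_mul_mul_comm, Real.mul_self_sqrt (by norm_num),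
    Real.mul_self_sqrt (by positivity)]

theorem ell1_eq (n : ℕ) (a x : ℝ) :
    ell1 n a x = normConst n a * laguerre n a (x ^ 2) * Real.exp (-x ^ 2 / 2) := rfl

theorem ell1_mul_ell1 (m n : ℕ) (a x : ℝ) :
    ell1 m a x * ell1 n a x = normConst m a * normConst n a *
      (laguerre m a (x ^ 2) * laguerre n a (x ^ 2) * Real.exp (-x ^ 2)) := by
  rw [← add_halves (-x ^ 2), Real.exp_add, ell1_eq, ell1_eq]
  ring

theorem integrable_ell1_mul_ell1 (ha : -1 < a) (m n : ℕ) :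
    Integrable (fun x => ell1 m a x * ell1 n a x) (powerMeasure a) := by
  simp only [ell1_mul_ell1]
  exact (integrable_laguerre_mul_laguerre_mul_exp ha m n).const_mul _

theorem integral_ell1_mul_ell1 (ha : -1 < a) (m n : ℕ) :
    ∫ x, ell1 m a x * ell1 n a x ∂powerMeasure a = if m = n then 1 else 0 := by
  simp only [ell1_mul_ell1]
  rw [integral_const_mul, integral_laguerre_mul_laguerre_mul_exp ha]
  split_ifs with h
  · subst h
    have := gamma_pos ha m
    rw [normConst_mul_self ha]
    field_simp
  · rw [mul_zero]

theorem continuous_laguerre (n : ℕ) (a : ℝ) : Continuous (laguerre n a) := by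
  unfold laguerre
  fun_prop

theorem continuous_ell1 (n : ℕ) (a : ℝ) : Continuous (ell1 n a) := by
  have := continuous_laguerre n a
  unfold ell1
  fun_prop

variable {d : ℕ} {α : Fin d → ℝ}

theorem continuous_ell (α : Fin d → ℝ) (k : Fin d → ℕ) : Continuous (ell α k) :=
  continuous_finsetProd _ fun i _ => (continuous_ell1 _ _).comp (continuous_apply i)

theorem ell_mul_ell (α : Fin d → ℝ) (j k : Fin d → ℕ) (x : Fin d → ℝ) :
    ell α j x * ell α k x = ∏ i, ell1 (j i) (α i) (x i) * ell1 (k i) (α i) (x i) :=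
  Finset.prod_mul_distrib.symm

theorem integral_ell_mul_ell (hα : ∀ i, -1 < α i) (j k : Fin d → ℕ) :
    ∫ x, ell α j x * ell α k x ∂measure α = if j = k then 1 else 0 := by
  simp only [ell_mul_ell, measure_eq_pi]
  rw [integral_fintype_prod_eq_prod fun i s => ell1 (j i) (α i) s * ell1 (k i) (α i) s]
  simp only [fun i => integral_ell1_mul_ell1 (hα i), Finset.prod_boole, Finset.mem_univ,
    forall_const, funext_iff]

theorem memLp_ell (hα : ∀ i, -1 < α i) (k : Fin d → ℕ) : MemLp (ell α k) 2 (measure α) := by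
  rw [memLp_two_iff_integrable_sq (continuous_ell α k).aestronglyMeasurable]
  simp only [pow_two, ell_mul_ell, measure_eq_pi]
  exact .fintype_prod fun i => integrable_ell1_mul_ell1 (hα i) _ _

end Orthogonality

section HeatKernel

variable {a t : ℝ}

theorem besselSeries_nonneg (ha : -1 < a) {z : ℝ} (hz : 0 ≤ z) : 0 ≤ besselSeries a z :=
  tsum_nonneg fun m => by
    have := gamma_pos ha m
    positivity

theorem exists_besselSeries_le (ha : -1 < a) {B ε : ℝ} (hB : 0 ≤ B) (hε : 0 < ε) :
    ∃ M, ∀ s, 0 ≤ s → besselSeries a (B * s) ≤ M * Real.exp (ε * s) := by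
  refine ⟨∑' m : ℕ, (B / ε) ^ m / Real.Gamma (m + a + 1), fun s hs => ?_⟩
  have hexp := NormedSpace.expSeries_div_hasSum_exp (ε * s)
  rw [← Real.exp_eq_exp_ℝ] at hexp
  refine hasSum_le (fun m => ?_) (hasSum_besselSeries ha (B * s)) (hexp.mul_left _)
  have hgamma := gamma_pos ha m
  calc (B * s) ^ m / (m.factorial * Real.Gamma (m + a + 1))
      = (B / ε) ^ m / Real.Gamma (m + a + 1) * ((ε * s) ^ m / m.factorial) := by
        rw [mul_pow, mul_pow, div_pow]
        field_simp
    _ ≤ _ := by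
        gcongr
        refine (summable_pow_div_gamma ha (B / ε)).le_tsum m fun j _ => ?_
        have := gamma_pos ha j
        positivity

theorem hasSum_integral_exp_mul_besselSeries_term (ha : -1 < a) {b c : ℝ} (hc : 0 < c) :
    HasSum (fun m : ℕ => ∫ x, b ^ m / (m.factorial * Real.Gamma (m + a + 1)) *
        ((x ^ 2) ^ m * Real.exp (-c * x ^ 2)) ∂powerMeasure a)
      (c ^ (-a - 1) / 2 * Real.exp (b / c)) := by
  have hexp := NormedSpace.expSeries_div_hasSum_exp (b / c)
  rw [← Real.exp_eq_exp_ℝ] at hexp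
  refine (hexp.mul_left (c ^ (-a - 1) / 2)).congr_fun fun m => ?_
  have := gamma_pos ha m
  rw [integral_const_mul, integral_sq_pow_mul_exp ha hc,
    show -((m : ℝ) + a + 1) = (-a - 1) - m by ring, Real.rpow_sub hc, Real.rpow_natCast, div_pow]
  field_simp

theorem integral_exp_mul_besselSeries (ha : -1 < a) {b c : ℝ} (hb : 0 ≤ b) (hc : 0 < c) :
    ∫ x, Real.exp (-c * x ^ 2) * besselSeries a (b * x ^ 2) ∂powerMeasure a =
      c ^ (-a - 1) / 2 * Real.exp (b / c) := by
  have hterm := hasSum_integral_exp_mul_besselSeries_term ha (b := b) hc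
  have hnorm : ∀ (m : ℕ) (x : ℝ), ‖b ^ m / (m.factorial * Real.Gamma (m + a + 1)) *
      ((x ^ 2) ^ m * Real.exp (-c * x ^ 2))‖ = b ^ m / (m.factorial * Real.Gamma (m + a + 1)) *
      ((x ^ 2) ^ m * Real.exp (-c * x ^ 2)) := fun m x => by
    have := gamma_pos ha m
    exact Real.norm_of_nonneg (by positivity)
  have hswap := hasSum_integral_of_summable_integral_norm
    (fun m : ℕ => (integrable_sq_pow_mul_exp ha hc m).const_mul
      (b ^ m / (m.factorial * Real.Gamma (m + a + 1))))
    (by simpa only [hnorm] using hterm.summable)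
  rw [← hswap.unique hterm]
  refine integral_congr_ae (.of_forall fun x => ?_)
  refine (((hasSum_besselSeries ha (b * x ^ 2)).mul_left (Real.exp (-c * x ^ 2))).congr_fun
    fun m => ?_).tsum_eq.symm
  rw [mul_pow]
  ring

/-- The one-dimensional heat kernel `∑ n, e^{-t (4 n + 2 a + 2)} ℓ_n^a(x) ℓ_n^a(y)` in the closed
form given by the Hille–Hardy formula. -/
noncomputable def heatKernel1 (a t x y : ℝ) : ℝ :=
  2 * (2 * Real.sinh (2 * t)) ^ (-a - 1) *
    Real.exp (-(Real.cosh (2 * t) / (2 * Real.sinh (2 * t))) * (x ^ 2 + y ^ 2)) *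
    besselSeries a ((x * y / (2 * Real.sinh (2 * t))) ^ 2)

theorem sinh_two_mul_pos (ht : 0 < t) : 0 < Real.sinh (2 * t) :=
  Real.sinh_pos_iff.2 (by linarith)

theorem heatKernel1_eq (a t x y : ℝ) :
    heatKernel1 a t x y = 2 * (2 * Real.sinh (2 * t)) ^ (-a - 1) *
      Real.exp (-(Real.cosh (2 * t) / (2 * Real.sinh (2 * t))) * x ^ 2) *
      (Real.exp (-(Real.cosh (2 * t) / (2 * Real.sinh (2 * t))) * y ^ 2) *
        besselSeries a ((x / (2 * Real.sinh (2 * t))) ^ 2 * y ^ 2)) := by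
  rw [heatKernel1, mul_add, Real.exp_add, mul_div_right_comm, mul_pow]
  ring

theorem heatKernel1_nonneg (ha : -1 < a) (ht : 0 < t) (x y : ℝ) : 0 ≤ heatKernel1 a t x y := by
  have := sinh_two_mul_pos ht
  have := besselSeries_nonneg ha (sq_nonneg (x * y / (2 * Real.sinh (2 * t))))
  unfold heatKernel1
  positivity

theorem exists_heatKernel1_le (ha : -1 < a) (ht : 0 < t) (x : ℝ) :
    ∃ M, ∀ y, heatKernel1 a t x y ≤ M := by
  have := sinh_two_mul_pos ht
  obtain ⟨M, hM⟩ := exists_besselSeries_le ha (sq_nonneg (x / (2 * Real.sinh (2 * t))))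
    (div_pos (Real.cosh_pos (2 * t)) (by positivity : 0 < 2 * Real.sinh (2 * t)))
  refine ⟨2 * (2 * Real.sinh (2 * t)) ^ (-a - 1) *
    Real.exp (-(Real.cosh (2 * t) / (2 * Real.sinh (2 * t))) * x ^ 2) * M, fun y => ?_⟩
  rw [heatKernel1_eq]
  gcongr
  refine (mul_le_mul_of_nonneg_left (hM (y ^ 2) (sq_nonneg y)) (Real.exp_pos _).le).trans_eq ?_
  rw [mul_left_comm, ← Real.exp_add, neg_mul, neg_add_cancel, Real.exp_zero, mul_one]

theorem one_sub_exp_neg_four_mul (t : ℝ) :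
    1 - Real.exp (-4 * t) = Real.exp (-2 * t) * (2 * Real.sinh (2 * t)) := by
  rw [Real.sinh_eq, mul_div_cancel₀ _ two_ne_zero, mul_sub, ← Real.exp_add, ← Real.exp_add]
  ring_nf
  rw [Real.exp_zero]
  ring

-- The change of variable `w = exp (-4 t)` in the Hille–Hardy formula.
theorem heatKernel1_eq_hille_hardy (ht : 0 < t) (x y : ℝ) :
    heatKernel1 a t x y =
      2 * Real.exp (-t * (2 * a + 2)) * Real.exp (-(x ^ 2 + y ^ 2) / 2) *
        ((1 - Real.exp (-4 * t)) ^ (-a - 1) *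
          Real.exp (-(x ^ 2 + y ^ 2) * Real.exp (-4 * t) / (1 - Real.exp (-4 * t))) *
          besselSeries a (x ^ 2 * y ^ 2 * Real.exp (-4 * t) / (1 - Real.exp (-4 * t)) ^ 2)) := by
  have := sinh_two_mul_pos ht
  have hexp := Real.exp_pos (-2 * t)
  have hw : Real.exp (-4 * t) = Real.exp (-2 * t) * Real.exp (-2 * t) := by
    rw [← Real.exp_add]
    ring_nf
  have hprefactor : Real.exp (-t * (2 * a + 2)) * (1 - Real.exp (-4 * t)) ^ (-a - 1) =
      (2 * Real.sinh (2 * t)) ^ (-a - 1) := by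
    rw [one_sub_exp_neg_four_mul, Real.mul_rpow hexp.le (by positivity), ← Real.exp_mul,
      ← mul_assoc, ← Real.exp_add, mul_eq_right₀ (by positivity), Real.exp_eq_one_iff]
    ring
  have hbessel : x ^ 2 * y ^ 2 * Real.exp (-4 * t) / (1 - Real.exp (-4 * t)) ^ 2 =
      (x * y / (2 * Real.sinh (2 * t))) ^ 2 := by
    rw [one_sub_exp_neg_four_mul, hw]
    field_simp
  have hgaussian : -(Real.cosh (2 * t) / (2 * Real.sinh (2 * t))) * (x ^ 2 + y ^ 2) =
      -(x ^ 2 + y ^ 2) / 2 +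
        -(x ^ 2 + y ^ 2) * Real.exp (-4 * t) / (1 - Real.exp (-4 * t)) := by
    have hcosh : Real.cosh (2 * t) = Real.sinh (2 * t) + Real.exp (-2 * t) := by
      rw [neg_mul, ← Real.cosh_sub_sinh, add_sub_cancel]
    rw [one_sub_exp_neg_four_mul, hw, hcosh]
    field_simp
    ring
  rw [heatKernel1, hgaussian, Real.exp_add, hbessel, ← hprefactor]
  ring

theorem hasSum_heatKernel1 (ha : -1 < a) (ht : 0 < t) (x y : ℝ) :
    HasSum (fun n : ℕ => Real.exp (-t * (4 * n + 2 * a + 2)) * (ell1 n a x * ell1 n a y))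
      (heatKernel1 a t x y) := by
  have hw : |Real.exp (-4 * t)| < 1 := by
    rw [Real.abs_exp, Real.exp_lt_one_iff]
    linarith
  rw [heatKernel1_eq_hille_hardy ht]
  refine ((hasSum_hille_hardy ha hw (x ^ 2) (y ^ 2)).mul_left _).congr_fun fun n => ?_
  have hexp : Real.exp (-t * (4 * n + 2 * a + 2)) =
      Real.exp (-t * (2 * a + 2)) * Real.exp (-4 * t) ^ n := by
    rw [← Real.exp_nat_mul, ← Real.exp_add]
    ring_nf
  have hgaussian : Real.exp (-(x ^ 2 + y ^ 2) / 2) =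
      Real.exp (-x ^ 2 / 2) * Real.exp (-y ^ 2 / 2) := by
    rw [← Real.exp_add]
    ring_nf
  rw [hexp, hgaussian, ell1_eq, ell1_eq]
  linear_combination Real.exp (-t * (2 * a + 2)) * Real.exp (-4 * t) ^ n * laguerre n a (x ^ 2) *
    laguerre n a (y ^ 2) * Real.exp (-x ^ 2 / 2) * Real.exp (-y ^ 2 / 2) * normConst_mul_self ha n

theorem integral_heatKernel1 (ha : -1 < a) (ht : 0 < t) (x : ℝ) :
    ∫ y, heatKernel1 a t x y ∂powerMeasure a =
      Real.cosh (2 * t) ^ (-a - 1) * Real.exp (-(x ^ 2 * Real.tanh (2 * t)) / 2) := by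
  have := sinh_two_mul_pos ht
  have hcosh := Real.cosh_pos (2 * t)
  have hdiv : 0 < Real.cosh (2 * t) / (2 * Real.sinh (2 * t)) := by positivity
  have hgaussian : -(x ^ 2 * Real.tanh (2 * t)) / 2 =
      -(Real.cosh (2 * t) / (2 * Real.sinh (2 * t))) * x ^ 2 +
        (x / (2 * Real.sinh (2 * t))) ^ 2 / (Real.cosh (2 * t) / (2 * Real.sinh (2 * t))) := by
    rw [Real.tanh_eq_sinh_div_cosh]
    field_simp
    linear_combination x ^ 2 * Real.cosh_sq (2 * t)
  simp only [heatKernel1_eq]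
  rw [integral_const_mul, integral_exp_mul_besselSeries ha (sq_nonneg _) hdiv, hgaussian,
    Real.exp_add, Real.div_rpow hcosh.le (by positivity)]
  field_simp

theorem integrable_heatKernel1 (ha : -1 < a) (ht : 0 < t) (x : ℝ) :
    Integrable (heatKernel1 a t x) (powerMeasure a) := by
  have := Real.cosh_pos (2 * t)
  refine .of_integral_ne_zero ?_
  rw [integral_heatKernel1 ha ht]
  positivity

theorem summable_exp_eigenvalue1 (a : ℝ) (ht : 0 < t) :
    Summable fun n : ℕ => Real.exp (-t * (4 * n + 2 * a + 2)) := by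
  refine ((summable_geometric_of_lt_one (Real.exp_pos _).le
    (Real.exp_lt_one_iff.2 (by linarith : -4 * t < 0))).mul_left
    (Real.exp (-t * (2 * a + 2)))).congr fun n => ?_
  rw [← Real.exp_nat_mul, ← Real.exp_add]
  ring_nf

theorem summable_exp_mul_ell1 (ha : -1 < a) (ht : 0 < t) (x : ℝ) :
    Summable fun n : ℕ => Real.exp (-t * (4 * n + 2 * a + 2)) * ell1 n a x := by
  refine .of_norm_bounded
    ((summable_exp_eigenvalue1 a ht).add (hasSum_heatKernel1 ha ht x x).summable) fun n => ?_
  rw [norm_mul, Real.norm_of_nonneg (Real.exp_pos _).le, ← mul_one_add, Real.norm_eq_abs]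
  gcongr
  exact abs_le.2 ⟨by nlinarith [sq_nonneg (ell1 n a x + 1)],
    by nlinarith [sq_nonneg (ell1 n a x - 1)]⟩

end HeatKernel

end LaguerreConv

section Schur

variable {X : Type*} [MeasurableSpace X] {μ : Measure X}

theorem lintegral_mul_rpow_le {k g : X → ℝ≥0∞} (hk : AEMeasurable k μ) (hg : AEMeasurable g μ)
    {p : ℝ} (hp : 1 ≤ p) :
    (∫⁻ y, k y * g y ∂μ) ^ p ≤ (∫⁻ y, k y ∂μ) ^ (p - 1) * ∫⁻ y, k y * g y ^ p ∂μ := by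
  have hp0 : 0 < p := zero_lt_one.trans_le hp
  have hexponent : (1 / 1 - 1 / p) * p = p - 1 := by field_simp
  have hjensen := eLpNorm'_le_eLpNorm'_mul_rpow_measure_univ (μ := μ.withDensity k) (f := g)
    one_pos hp (hg.mono_ac (withDensity_absolutelyContinuous μ k)).aestronglyMeasurable
  calc (∫⁻ y, k y * g y ∂μ) ^ p
      = eLpNorm' g 1 (μ.withDensity k) ^ p := by
        simp only [eLpNorm', enorm_eq_self, ENNReal.rpow_one, div_one,
          lintegral_withDensity_eq_lintegral_mul₀ hk hg, Pi.mul_apply]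
    _ ≤ (eLpNorm' g p (μ.withDensity k) *
          μ.withDensity k Set.univ ^ (1 / 1 - 1 / p)) ^ p := by gcongr
    _ = (∫⁻ y, k y ∂μ) ^ (p - 1) * ∫⁻ y, k y * g y ^ p ∂μ := by
        rw [ENNReal.mul_rpow_of_nonneg _ _ hp0.le, ← ENNReal.rpow_mul _ _ p, hexponent, eLpNorm',
          ← ENNReal.rpow_mul, one_div_mul_cancel hp0.ne', ENNReal.rpow_one, mul_comm,
          withDensity_apply _ .univ, Measure.restrict_univ]
        simp only [enorm_eq_self, lintegral_withDensity_eq_lintegral_mul₀ hk (hg.pow_const p),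
          Pi.mul_apply]

variable [SFinite μ] {C : ℝ≥0∞}

theorem lintegral_lintegral_mul_rpow_le {k : X → X → ℝ≥0∞} (hk : Measurable (Function.uncurry k))
    (hrow : ∀ x, ∫⁻ y, k x y ∂μ ≤ C) (hcol : ∀ y, ∫⁻ x, k x y ∂μ ≤ C) {g : X → ℝ≥0∞}
    (hg : AEMeasurable g μ) {p : ℝ} (hp : 1 ≤ p) :
    ∫⁻ x, (∫⁻ y, k x y * g y ∂μ) ^ p ∂μ ≤ C ^ p * ∫⁻ y, g y ^ p ∂μ := by
  have hprod : AEMeasurable (Function.uncurry fun x y => k x y * g y ^ p) (μ.prod μ) :=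
    hk.aemeasurable.mul (hg.pow_const p).comp_snd
  calc ∫⁻ x, (∫⁻ y, k x y * g y ∂μ) ^ p ∂μ
      ≤ ∫⁻ x, C ^ (p - 1) * ∫⁻ y, k x y * g y ^ p ∂μ ∂μ := by
        refine lintegral_mono fun x =>
          (lintegral_mul_rpow_le hk.of_uncurry_left.aemeasurable hg hp).trans ?_
        gcongr
        exact hrow x
    _ = C ^ (p - 1) * ∫⁻ y, (∫⁻ x, k x y ∂μ) * g y ^ p ∂μ := by
        have hinner : AEMeasurable (fun x => ∫⁻ y, k x y * g y ^ p ∂μ) μ :=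
          hprod.lintegral_prod_right'
        rw [lintegral_const_mul'' _ hinner, lintegral_lintegral_swap hprod]
        simp only [lintegral_mul_const _ hk.of_uncurry_right]
    _ ≤ C ^ (p - 1) * ∫⁻ y, C * g y ^ p ∂μ := by
        gcongr with y
        exact hcol y
    _ = C ^ p * ∫⁻ y, g y ^ p ∂μ := by
        rw [lintegral_const_mul'' _ (hg.pow_const p), ← mul_assoc]
        nth_rw 2 [← ENNReal.rpow_one C]
        rw [← ENNReal.rpow_add_of_nonneg _ _ (sub_nonneg.2 hp) zero_le_one, sub_add_cancel]

variable {E : Type*} [NormedAddCommGroup E] [NormedSpace ℝ E] {K : X → X → ℝ} {f : X → E}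

theorem eLpNorm_integral_smul_le (hK : Measurable (Function.uncurry K))
    (hrow : ∀ x, ∫⁻ y, ‖K x y‖ₑ ∂μ ≤ C) (hcol : ∀ y, ∫⁻ x, ‖K x y‖ₑ ∂μ ≤ C) {p : ℝ≥0∞}
    (hp : 1 ≤ p) (hf : AEStronglyMeasurable f μ) :
    eLpNorm (fun x => ∫ y, K x y • f y ∂μ) p μ ≤ C * eLpNorm f p μ := by
  have hpointwise : ∀ x, ‖∫ y, K x y • f y ∂μ‖ₑ ≤ ∫⁻ y, ‖K x y‖ₑ * ‖f y‖ₑ ∂μ := fun x =>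
    (enorm_integral_le_lintegral_enorm _).trans_eq (by simp only [enorm_smul])
  rcases eq_or_ne p ∞ with rfl | hp_top
  · rw [eLpNorm_exponent_top, eLpNorm_exponent_top]
    refine eLpNormEssSup_le_of_ae_enorm_bound (.of_forall fun x => (hpointwise x).trans ?_)
    calc ∫⁻ y, ‖K x y‖ₑ * ‖f y‖ₑ ∂μ
        ≤ ∫⁻ y, ‖K x y‖ₑ * eLpNormEssSup f μ ∂μ :=
          lintegral_mono_ae (enorm_ae_le_eLpNormEssSup f μ |>.mono fun y hy => by gcongr)
      _ = (∫⁻ y, ‖K x y‖ₑ ∂μ) * eLpNormEssSup f μ :=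
          lintegral_mul_const _ hK.of_uncurry_left.enorm
      _ ≤ C * eLpNormEssSup f μ := by
          gcongr
          exact hrow x
  · have hp0 : p ≠ 0 := (zero_lt_one.trans_le hp).ne'
    have hp_real : 1 ≤ p.toReal := ENNReal.toReal_one ▸ ENNReal.toReal_mono hp_top hp
    have hp_real_ne : p.toReal ≠ 0 := (zero_lt_one.trans_le hp_real).ne'
    rw [eLpNorm_eq_lintegral_rpow_enorm_toReal hp0 hp_top,
      eLpNorm_eq_lintegral_rpow_enorm_toReal hp0 hp_top]
    calc (∫⁻ x, ‖∫ y, K x y • f y ∂μ‖ₑ ^ p.toReal ∂μ) ^ (1 / p.toReal)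
        ≤ (∫⁻ x, (∫⁻ y, ‖K x y‖ₑ * ‖f y‖ₑ ∂μ) ^ p.toReal ∂μ) ^ (1 / p.toReal) := by
          gcongr with x
          exact hpointwise x
      _ ≤ (C ^ p.toReal * ∫⁻ y, ‖f y‖ₑ ^ p.toReal ∂μ) ^ (1 / p.toReal) := by
          gcongr
          exact lintegral_lintegral_mul_rpow_le hK.enorm hrow hcol hf.enorm hp_real
      _ = C * (∫⁻ y, ‖f y‖ₑ ^ p.toReal ∂μ) ^ (1 / p.toReal) := by
          rw [ENNReal.mul_rpow_of_nonneg _ _ (by positivity), ← ENNReal.rpow_mul,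
            mul_one_div_cancel hp_real_ne, ENNReal.rpow_one]

end Schur

section SumSpace

variable {X : Type*} [MeasurableSpace X] {μ : Measure X} {𝕜 : Type*} [RCLike 𝕜] {f : X → 𝕜}

theorem norm_sub_inv_max_smul_le_rpow (z : 𝕜) {p : ℝ} (hp : 1 ≤ p) :
    ‖z - (max 1 ‖z‖)⁻¹ • z‖ ≤ ‖z‖ ^ p := by
  rcases le_total ‖z‖ 1 with hz | hz
  · rw [max_eq_left hz, inv_one, one_smul, sub_self, norm_zero]
    positivity
  · have hcoeff : ‖z - ‖z‖⁻¹ • z‖ ≤ ‖z‖ := by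
      have hinv : ‖z‖⁻¹ ≤ 1 := inv_le_one_of_one_le₀ hz
      have : 0 ≤ ‖z‖⁻¹ := by positivity
      rw [show z - ‖z‖⁻¹ • z = (1 - ‖z‖⁻¹) • z by rw [sub_smul, one_smul], norm_smul,
        Real.norm_of_nonneg (sub_nonneg.2 hinv)]
      nlinarith [norm_nonneg z]
    rw [max_eq_right hz]
    exact hcoeff.trans (Real.self_le_rpow_of_one_le hz hp)

theorem memL1AddLinfty_of_memLp {p : ℝ≥0∞} (hp : 1 ≤ p) (hf : MemLp f p μ) :
    MemL1AddLinfty f μ := by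
  rcases eq_or_ne p ∞ with rfl | hp_top
  · exact ⟨0, f, MemLp.zero, hf, (zero_add f).symm⟩
  have hp0 : p ≠ 0 := (zero_lt_one.trans_le hp).ne'
  have hp_real : 1 ≤ p.toReal := ENNReal.toReal_one ▸ ENNReal.toReal_mono hp_top hp
  have hcont : Continuous fun z : 𝕜 => (max 1 ‖z‖)⁻¹ • z :=
    ((continuous_const.max continuous_norm).inv₀ fun z =>
      (zero_lt_one.trans_le (le_max_left 1 ‖z‖)).ne').smul continuous_id
  have hmeas := hcont.comp_aestronglyMeasurable hf.1
  refine ⟨fun x => f x - (max 1 ‖f x‖)⁻¹ • f x, fun x => (max 1 ‖f x‖)⁻¹ • f x,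
    memLp_one_iff_integrable.2 ((hf.integrable_norm_rpow hp0 hp_top).mono' (hf.1.sub hmeas)
      (.of_forall fun x => norm_sub_inv_max_smul_le_rpow (f x) hp_real)),
    memLp_top_of_bound hmeas 1 (.of_forall fun x => ?_), (sub_add_cancel _ _).symm⟩
  rw [norm_smul, norm_inv, Real.norm_of_nonneg (by positivity), inv_mul_le_one₀ (by positivity)]
  exact le_max_right _ _

theorem MemL1AddLinfty.aestronglyMeasurable (hf : MemL1AddLinfty f μ) :
    AEStronglyMeasurable f μ := by
  obtain ⟨g, h, hg, hh, rfl⟩ := hf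
  exact hg.1.add hh.1

theorem MemL1AddLinfty.integrable_smul {k : X → ℝ} (hf : MemL1AddLinfty f μ)
    (hk : Integrable k μ) {M : ℝ} (hM : ∀ x, ‖k x‖ ≤ M) : Integrable (fun x => k x • f x) μ := by
  obtain ⟨g, h, hg, hh, rfl⟩ := hf
  simp only [Pi.add_apply, smul_add]
  exact ((memLp_one_iff_integrable.1 hg).bdd_smul M hk.1 (.of_forall hM)).add
    (hk.smul_of_top_left hh)

end SumSpace

section SymmetricKernel

variable {X : Type*} [MeasurableSpace X]

/-- A jointly measurable, nonnegative, symmetric kernel `K` on `(X, μ)` of total mass at most `C`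
in each variable. The pointwise bound (not uniform in `x`) makes `∫ K x y f y dμ(y)` converge for
every `x` and every `f` in `L¹(μ) + L^∞(μ)`. -/
structure IsSymmetricKernel (K : X → X → ℝ) (μ : Measure X) (C : ℝ) : Prop where
  measurable : Measurable (Function.uncurry K)
  nonneg : ∀ x y, 0 ≤ K x y
  symm : ∀ x y, K x y = K y x
  exists_le : ∀ x, ∃ M, ∀ y, K x y ≤ M
  integrable : ∀ x, Integrable (K x) μ
  integral_le : ∀ x, ∫ y, K x y ∂μ ≤ C

namespace IsSymmetricKernel

variable {μ : Measure X} {K K₁ K₂ : X → X → ℝ} {C C₁ C₂ : ℝ} {𝕜 : Type*} [RCLike 𝕜] {f g : X → 𝕜}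

theorem mono {C' : ℝ} (hK : IsSymmetricKernel K μ C) (hCC' : C ≤ C') : IsSymmetricKernel K μ C' :=
  { hK with integral_le := fun x => (hK.integral_le x).trans hCC' }

theorem lintegral_enorm_le (hK : IsSymmetricKernel K μ C) (x : X) :
    ∫⁻ y, ‖K x y‖ₑ ∂μ ≤ ENNReal.ofReal C := by
  rw [← ofReal_integral_norm_eq_lintegral_enorm (hK.integrable x)]
  simp only [Real.norm_of_nonneg (hK.nonneg x _)]
  exact ENNReal.ofReal_le_ofReal (hK.integral_le x)

theorem integrable_smul (hK : IsSymmetricKernel K μ C) (hf : MemL1AddLinfty f μ) (x : X) :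
    Integrable (fun y => K x y • f y) μ := by
  obtain ⟨M, hM⟩ := hK.exists_le x
  exact hf.integrable_smul (hK.integrable x) fun y =>
    (Real.norm_of_nonneg (hK.nonneg x y)).trans_le (hM y)

theorem integral_add (hK : IsSymmetricKernel K μ C) (hf : MemL1AddLinfty f μ)
    (hg : MemL1AddLinfty g μ) (x : X) :
    ∫ y, K x y • (f + g) y ∂μ = ∫ y, K x y • f y ∂μ + ∫ y, K x y • g y ∂μ := by
  simp only [Pi.add_apply, smul_add]
  exact MeasureTheory.integral_add (hK.integrable_smul hf x) (hK.integrable_smul hg x)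

theorem integral_nonneg (hK : IsSymmetricKernel K μ C) (hf : ∀ᵐ x ∂μ, 0 ≤ f x) (x : X) :
    0 ≤ ∫ y, K x y • f y ∂μ := by
  refine integral_nonneg_of_ae ?_
  filter_upwards [hf] with y hy
  exact smul_nonneg (hK.nonneg x y) hy

theorem integrable_mul_right (hK₁ : IsSymmetricKernel K₁ μ C₁) (hK₂ : IsSymmetricKernel K₂ μ C₂)
    (x y : X) : Integrable (fun z => K₁ x z * K₂ z y) μ := by
  obtain ⟨M, hM⟩ := hK₁.exists_le x
  simp only [hK₂.symm _ y]
  exact (hK₂.integrable y).bdd_mul hK₁.measurable.of_uncurry_left.aestronglyMeasurable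
    (.of_forall fun z => (Real.norm_of_nonneg (hK₁.nonneg x z)).trans_le (hM z))

variable [SFinite μ]

theorem aestronglyMeasurable_integral_smul (hK : IsSymmetricKernel K μ C)
    (hf : AEStronglyMeasurable f μ) :
    AEStronglyMeasurable (fun x => ∫ y, K x y • f y ∂μ) μ :=
  AEStronglyMeasurable.integral_prod_right' (f := fun z : X × X => K z.1 z.2 • f z.2)
    (hK.measurable.aestronglyMeasurable.smul hf.comp_snd)

theorem eLpNorm_integral_smul_le (hK : IsSymmetricKernel K μ C) {p : ℝ≥0∞} (hp : 1 ≤ p)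
    (hf : AEStronglyMeasurable f μ) :
    eLpNorm (fun x => ∫ y, K x y • f y ∂μ) p μ ≤ ENNReal.ofReal C * eLpNorm f p μ :=
  _root_.eLpNorm_integral_smul_le hK.measurable hK.lintegral_enorm_le
    (fun y => by simpa only [hK.symm _ y] using hK.lintegral_enorm_le y) hp hf

theorem memLp_integral_smul (hK : IsSymmetricKernel K μ C) {p : ℝ≥0∞} (hp : 1 ≤ p)
    (hf : MemLp f p μ) : MemLp (fun x => ∫ y, K x y • f y ∂μ) p μ :=
  ⟨hK.aestronglyMeasurable_integral_smul hf.1, (hK.eLpNorm_integral_smul_le hp hf.1).trans_lt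
    (ENNReal.mul_lt_top ENNReal.ofReal_lt_top hf.2)⟩

theorem integral_smul_integral_smul {K₃ : X → X → ℝ} {C₃ : ℝ} (hK₁ : IsSymmetricKernel K₁ μ C₁)
    (hK₂ : IsSymmetricKernel K₂ μ C₂) (hK₃ : IsSymmetricKernel K₃ μ C₃)
    (hcomp : ∀ x y, ∫ z, K₁ x z * K₂ z y ∂μ = K₃ x y) (hf : MemL1AddLinfty f μ) (x : X) :
    ∫ z, K₁ x z • ∫ y, K₂ z y • f y ∂μ ∂μ = ∫ y, K₃ x y • f y ∂μ := by
  have hmeas : AEStronglyMeasurable (Function.uncurry fun z y =>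
      K₁ x z • K₂ z y • f y) (μ.prod μ) :=
    (hK₁.measurable.of_uncurry_left.comp measurable_fst).aestronglyMeasurable.smul
      (hK₂.measurable.aestronglyMeasurable.smul hf.aestronglyMeasurable.comp_snd)
  have hintegrable : Integrable (Function.uncurry fun z y => K₁ x z • K₂ z y • f y)
      (μ.prod μ) := by
    refine (integrable_prod_iff' hmeas).2 ⟨.of_forall fun y => ?_, ?_⟩
    · simp only [Function.uncurry, smul_smul]
      exact (hK₁.integrable_mul_right hK₂ x y).smul_const _
    · refine (hK₃.integrable_smul hf x).norm.congr (.of_forall fun y => ?_)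
      simp only [Function.uncurry, smul_smul, norm_smul, norm_mul,
        Real.norm_of_nonneg (hK₁.nonneg _ _), Real.norm_of_nonneg (hK₂.nonneg _ _),
        Real.norm_of_nonneg (hK₃.nonneg _ _)]
      rw [integral_mul_const, hcomp]
  simp only [← integral_smul]
  rw [integral_integral_swap hintegrable]
  simp only [smul_smul, integral_smul_const, hcomp]

theorem integral_integral_smul_mul_star (hK : IsSymmetricKernel K μ C) (hf : MemLp f 2 μ)
    (hg : MemLp g 2 μ) :
    ∫ x, (∫ y, K x y • f y ∂μ) * star (g x) ∂μ =
      ∫ x, f x * star (∫ y, K x y • g y ∂μ) ∂μ := by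
  have hmeas : AEStronglyMeasurable (Function.uncurry fun x y => (K x y • f y) * star (g x))
      (μ.prod μ) :=
    (hK.measurable.aestronglyMeasurable.smul hf.1.comp_snd).mul
      (continuous_star.comp_aestronglyMeasurable hg.1.comp_fst)
  have hintegrable : Integrable (Function.uncurry fun x y => (K x y • f y) * star (g x))
      (μ.prod μ) := by
    refine (integrable_prod_iff hmeas).2 ⟨.of_forall fun x => ?_, ?_⟩
    · exact (hK.integrable_smul (memL1AddLinfty_of_memLp one_le_two hf) x).mul_const (star (g x))
    refine ((hK.memLp_integral_smul one_le_two hf.norm).integrable_mul hg.norm).congr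
      (.of_forall fun x => ?_)
    simp only [Function.uncurry, Pi.mul_apply, norm_mul, norm_star, norm_smul, smul_eq_mul,
      integral_mul_const, Real.norm_of_nonneg (hK.nonneg _ _)]
  have hstar : ∀ y, star (∫ x, K y x • g x ∂μ) = ∫ x, star (K y x • g x) ∂μ := fun y =>
    integral_conj.symm
  simp only [← integral_mul_const, hstar, ← integral_const_mul]
  rw [integral_integral_swap hintegrable]
  simp only [star_smul, star_trivial, hK.symm _, smul_mul_assoc, mul_smul_comm]

end IsSymmetricKernel

variable {𝕜 : Type*} [RCLike 𝕜]

/-- The family of operators `T 0 f = f` and `T t f x = ∫ K t x y f y dμ(y)`, `t > 0`, attached to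
a family of kernels. -/
noncomputable def kernelSemigroup (𝕜 : Type*) [RCLike 𝕜] (K : ℝ → X → X → ℝ) (μ : Measure X)
    (t : ℝ) (f : X → 𝕜) (x : X) : 𝕜 :=
  if t = 0 then f x else ∫ y, K t x y • f y ∂μ

variable {K : ℝ → X → X → ℝ} {μ : Measure X} {t : ℝ}

theorem kernelSemigroup_zero (K : ℝ → X → X → ℝ) (μ : Measure X) (f : X → 𝕜) :
    kernelSemigroup 𝕜 K μ 0 f = f :=
  funext fun _ => if_pos rfl

theorem kernelSemigroup_of_pos (ht : 0 < t) (f : X → 𝕜) :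
    kernelSemigroup 𝕜 K μ t f = fun x => ∫ y, K t x y • f y ∂μ :=
  funext fun _ => if_neg ht.ne'

theorem kernelSemigroup_one (ht : 0 < t) (x : X) :
    kernelSemigroup 𝕜 K μ t (fun _ => 1) x = ((∫ y, K t x y ∂μ : ℝ) : 𝕜) := by
  simp only [kernelSemigroup_of_pos ht, RCLike.real_smul_eq_coe_mul, mul_one, integral_ofReal]

variable [SFinite μ]

theorem lpOpNorm_kernelSemigroup_le {C : ℝ} (hK : IsSymmetricKernel (K t) μ C) (ht : 0 < t)
    {p : ℝ≥0∞} (hp : 1 ≤ p) : lpOpNorm (kernelSemigroup 𝕜 K μ t) p μ ≤ ENNReal.ofReal C :=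
  sInf_le fun f hf => by
    rw [kernelSemigroup_of_pos ht]
    exact hK.eLpNorm_integral_smul_le hp hf.1

theorem memLp_kernelSemigroup {C : ℝ} (hK : ∀ t, 0 < t → IsSymmetricKernel (K t) μ C)
    (ht : 0 ≤ t) {p : ℝ≥0∞} (hp : 1 ≤ p) {f : X → 𝕜} (hf : MemLp f p μ) :
    MemLp (kernelSemigroup 𝕜 K μ t f) p μ := by
  rcases ht.eq_or_lt with rfl | ht
  · rwa [kernelSemigroup_zero]
  · rw [kernelSemigroup_of_pos ht]
    exact (hK t ht).memLp_integral_smul hp hf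

theorem kernelSemigroup_add {C : ℝ} (hK : ∀ t, 0 < t → IsSymmetricKernel (K t) μ C)
    (hadd : ∀ s t, 0 < s → 0 < t → ∀ x y, ∫ z, K s x z * K t z y ∂μ = K (s + t) x y) {s : ℝ}
    (hs : 0 ≤ s) (ht : 0 ≤ t) {f : X → 𝕜} (hf : MemL1AddLinfty f μ) :
    kernelSemigroup 𝕜 K μ (s + t) f = kernelSemigroup 𝕜 K μ s (kernelSemigroup 𝕜 K μ t f) := by
  rcases hs.eq_or_lt with rfl | hs
  · rw [zero_add, kernelSemigroup_zero]
  rcases ht.eq_or_lt with rfl | ht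
  · rw [add_zero, kernelSemigroup_zero]
  simp only [kernelSemigroup_of_pos, hs, ht, add_pos]
  exact funext fun x => ((hK s hs).integral_smul_integral_smul (hK t ht)
    (hK _ (add_pos hs ht)) (hadd s t hs ht) hf x).symm

theorem isSymmetricDiffusionSemigroup_kernelSemigroup
    (hK : ∀ t, 0 < t → IsSymmetricKernel (K t) μ 1)
    (hadd : ∀ s t, 0 < s → 0 < t → ∀ x y, ∫ z, K s x z * K t z y ∂μ = K (s + t) x y)
    (hcont : ∀ f : X → 𝕜, MemLp f 2 μ →
      Tendsto (fun t => eLpNorm (kernelSemigroup 𝕜 K μ t f - f) 2 μ) (𝓝[>] 0) (𝓝 0)) :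
    IsSymmetricDiffusionSemigroup (kernelSemigroup 𝕜 K μ) μ where
  aestronglyMeasurable t ht f hf := by
    rcases ht.eq_or_lt with rfl | ht
    · rw [kernelSemigroup_zero]
      exact hf.aestronglyMeasurable
    · rw [kernelSemigroup_of_pos ht]
      exact (hK t ht).aestronglyMeasurable_integral_smul hf.aestronglyMeasurable
  congr_ae t ht f g _ _ hfg := by
    rcases ht.eq_or_lt with rfl | ht
    · rwa [kernelSemigroup_zero, kernelSemigroup_zero]
    · rw [kernelSemigroup_of_pos ht, kernelSemigroup_of_pos ht]
      exact .of_forall fun x => integral_congr_ae (hfg.mono fun y hy => congrArg (K t x y • ·) hy)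
  map_add t ht f g hf hg := by
    rcases ht.eq_or_lt with rfl | ht
    · simp only [kernelSemigroup_zero, EventuallyEq.rfl]
    · simp only [kernelSemigroup_of_pos ht]
      exact .of_forall fun x => (hK t ht).integral_add hf hg x
  map_smul t ht c f _ := by
    rcases ht.eq_or_lt with rfl | ht
    · simp only [kernelSemigroup_zero, EventuallyEq.rfl]
    · simp only [kernelSemigroup_of_pos ht, Pi.smul_apply, smul_comm _ c, integral_smul]
      rfl
  zero f _ := by rw [kernelSemigroup_zero]
  memLp p hp t ht f hf := memLp_kernelSemigroup hK ht hp hf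
  contraction p hp t ht := by
    rcases ht.eq_or_lt with rfl | ht
    · exact sInf_le fun f _ => by rw [kernelSemigroup_zero, one_mul]
    · simpa only [ENNReal.ofReal_one] using lpOpNorm_kernelSemigroup_le (hK t ht) ht hp
  semigroup p hp s t hs ht f hf := by
    rw [kernelSemigroup_add hK hadd hs ht (memL1AddLinfty_of_memLp hp hf)]
  selfAdjoint t ht f g hf hg := by
    rcases ht.eq_or_lt with rfl | ht
    · rw [kernelSemigroup_zero, kernelSemigroup_zero]
    · simp only [kernelSemigroup_of_pos ht]
      exact (hK t ht).integral_integral_smul_mul_star hf hg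
  continuous_zero := hcont

theorem isSubmarkovianSemigroup_kernelSemigroup
    (hK : ∀ t, 0 < t → IsSymmetricKernel (K t) μ 1)
    (hadd : ∀ s t, 0 < s → 0 < t → ∀ x y, ∫ z, K s x z * K t z y ∂μ = K (s + t) x y)
    (hcont : ∀ f : X → 𝕜, MemLp f 2 μ →
      Tendsto (fun t => eLpNorm (kernelSemigroup 𝕜 K μ t f - f) 2 μ) (𝓝[>] 0) (𝓝 0)) :
    IsSubmarkovianSemigroup (kernelSemigroup 𝕜 K μ) μ where
  isSymmetricDiffusionSemigroup := isSymmetricDiffusionSemigroup_kernelSemigroup hK hadd hcont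
  positive t ht f _ hf := by
    rcases ht.eq_or_lt with rfl | ht
    · rwa [kernelSemigroup_zero]
    · rw [kernelSemigroup_of_pos ht]
      exact .of_forall fun x => (hK t ht).integral_nonneg hf x
  subconservative t ht := by
    rcases ht.eq_or_lt with rfl | ht
    · rw [kernelSemigroup_zero]
      exact .of_forall fun _ => le_refl (1 : 𝕜)
    · refine .of_forall fun x => ?_
      rw [kernelSemigroup_one ht, ← RCLike.ofReal_one, RCLike.ofReal_le_ofReal]
      exact (hK t ht).integral_le x

end SymmetricKernel

section OrthonormalSystem

variable {X ι : Type*} [MeasurableSpace X] [DecidableEq ι]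

/-- An orthonormal system of real functions in `L²(μ)`. -/
structure IsOrthonormalSystem (e : ι → X → ℝ) (μ : Measure X) : Prop where
  memLp : ∀ k, MemLp (e k) 2 μ
  integral_mul : ∀ j k, ∫ x, e j x * e k x ∂μ = if j = k then 1 else 0

/-- An orthonormal basis of `L²(μ)` made of real functions. Completeness is required for real
functions only; it passes to complex ones through real and imaginary parts. -/
structure IsCompleteOrthonormalSystem (e : ι → X → ℝ) (μ : Measure X) : Prop
    extends IsOrthonormalSystem e μ where
  ae_eq_zero : ∀ f : X → ℝ, MemLp f 2 μ → (∀ k, ∫ x, e k x * f x ∂μ = 0) → f =ᵐ[μ] 0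

variable {μ : Measure X} {e : ι → X → ℝ} {𝕜 : Type*} [RCLike 𝕜] {f : X → 𝕜}

namespace IsOrthonormalSystem

theorem integrable_smul (he : IsOrthonormalSystem e μ) (hf : MemLp f 2 μ) (k : ι) :
    Integrable (fun x => e k x • f x) μ :=
  memLp_one_iff_integrable.1 (hf.smul (he.memLp k))

theorem integral_norm_smul_le (he : IsOrthonormalSystem e μ) (hf : MemLp f 2 μ) (k : ι) :
    ∫ x, ‖e k x • f x‖ ∂μ ≤ 1 + ∫ x, ‖f x‖ ^ 2 ∂μ := by
  have hsq : ∫ x, e k x ^ 2 ∂μ = 1 := by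
    simpa only [← pow_two, if_pos] using he.integral_mul k k
  rw [← hsq, ← integral_add (he.memLp k).integrable_sq hf.norm.integrable_sq]
  refine integral_mono (he.integrable_smul hf k).norm
    ((he.memLp k).integrable_sq.add hf.norm.integrable_sq) fun x => ?_
  simp only [norm_smul, Real.norm_eq_abs]
  nlinarith [sq_nonneg (|e k x| - ‖f x‖), sq_abs (e k x), sq_nonneg (e k x), sq_nonneg ‖f x‖]

theorem hasSum_smul_integral [Countable ι] (he : IsOrthonormalSystem e μ) {c : ι → ℝ}
    (hc : Summable c) {F : X → ℝ} (hF : ∀ᵐ x ∂μ, HasSum (fun k => c k * e k x) (F x))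
    (hf : MemLp f 2 μ) :
    HasSum (fun k => c k • ∫ x, e k x • f x ∂μ) (∫ x, F x • f x ∂μ) := by
  have hsum := hasSum_integral_of_summable_integral_norm
    (F := fun k x => c k • e k x • f x) (fun k => (he.integrable_smul hf k).smul (c k)) <| by
      simp only [norm_smul (c _), integral_const_mul]
      exact Summable.of_nonneg_of_le
        (fun k => mul_nonneg (norm_nonneg _) (integral_nonneg fun x => norm_nonneg _))
        (fun k => mul_le_mul_of_nonneg_left (he.integral_norm_smul_le hf k) (norm_nonneg _))
        (hc.norm.mul_right _)
  simp only [integral_smul] at hsum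
  convert! hsum using 1
  refine integral_congr_ae (hF.mono fun x hx => ?_)
  simpa only [mul_smul] using (hx.smul_const (f x)).tsum_eq.symm

/-- The functions of an orthonormal system as elements of the `𝕜`-valued `L²(μ)`. -/
noncomputable def toLp (𝕜 : Type*) [RCLike 𝕜] (he : IsOrthonormalSystem e μ) (k : ι) : Lp 𝕜 2 μ :=
  ((he.memLp k).ofReal).toLp fun x => (e k x : 𝕜)

theorem coeFn_toLp (he : IsOrthonormalSystem e μ) (k : ι) :
    he.toLp 𝕜 k =ᵐ[μ] fun x => (e k x : 𝕜) :=
  MemLp.coeFn_toLp _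

theorem inner_toLp (he : IsOrthonormalSystem e μ) (k : ι) (f : Lp 𝕜 2 μ) :
    inner 𝕜 (he.toLp 𝕜 k) f = ∫ x, e k x • f x ∂μ := by
  rw [L2.inner_def]
  refine integral_congr_ae ?_
  filter_upwards [he.coeFn_toLp (𝕜 := 𝕜) k] with x hx
  rw [hx, RCLike.inner_apply, RCLike.conj_ofReal, RCLike.real_smul_eq_coe_mul, mul_comm]

theorem orthonormal_toLp (he : IsOrthonormalSystem e μ) : Orthonormal 𝕜 (he.toLp 𝕜) := by
  rw [orthonormal_iff_ite]
  intro j k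
  have hreal : ∫ x, e j x • he.toLp 𝕜 k x ∂μ = ∫ x, ((e j x * e k x : ℝ) : 𝕜) ∂μ := by
    refine integral_congr_ae ?_
    filter_upwards [he.coeFn_toLp (𝕜 := 𝕜) k] with x hx
    rw [hx, RCLike.real_smul_eq_coe_mul, RCLike.ofReal_mul]
  rw [he.inner_toLp, hreal, integral_ofReal, he.integral_mul]
  split_ifs <;> simp

end IsOrthonormalSystem

namespace IsCompleteOrthonormalSystem

theorem ae_eq_zero_of_integral_smul (he : IsCompleteOrthonormalSystem e μ) (hf : MemLp f 2 μ)
    (horth : ∀ k, ∫ x, e k x • f x ∂μ = 0) : f =ᵐ[μ] 0 := by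
  have hre := he.ae_eq_zero _ hf.re fun k => by
    simpa [horth k, RCLike.smul_re] using integral_re (he.integrable_smul hf k)
  have him := he.ae_eq_zero _ hf.im fun k => by
    simpa [horth k, RCLike.smul_im] using integral_im (he.integrable_smul hf k)
  filter_upwards [hre, him] with x hx_re hx_im
  exact RCLike.ext (by simpa using hx_re) (by simpa using hx_im)

theorem orthogonal_span_toLp (he : IsCompleteOrthonormalSystem e μ) :
    (Submodule.span 𝕜 (Set.range (he.toLp 𝕜)))ᗮ = ⊥ := by
  refine (Submodule.eq_bot_iff _).2 fun f hf => Lp.eq_zero_iff_ae_eq_zero.2 ?_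
  refine he.ae_eq_zero_of_integral_smul (Lp.memLp f) fun k => ?_
  rw [← he.inner_toLp]
  exact (Submodule.mem_orthogonal _ _).1 hf _ (Submodule.subset_span ⟨k, rfl⟩)

/-- The Hilbert basis of the `𝕜`-valued `L²(μ)` given by a complete orthonormal system. -/
noncomputable def hilbertBasis (𝕜 : Type*) [RCLike 𝕜] (he : IsCompleteOrthonormalSystem e μ) :
    HilbertBasis ι 𝕜 (Lp 𝕜 2 μ) :=
  HilbertBasis.mkOfOrthogonalEqBot he.orthonormal_toLp he.orthogonal_span_toLp

theorem hilbertBasis_apply (he : IsCompleteOrthonormalSystem e μ) (k : ι) :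
    he.hilbertBasis 𝕜 k = he.toLp 𝕜 k :=
  congrFun (HilbertBasis.coe_mkOfOrthogonalEqBot _ _) k

theorem repr_toLp (he : IsCompleteOrthonormalSystem e μ) (hf : MemLp f 2 μ) (k : ι) :
    (he.hilbertBasis 𝕜).repr (hf.toLp f) k = ∫ x, e k x • f x ∂μ := by
  rw [HilbertBasis.repr_apply_apply, hilbertBasis_apply, he.inner_toLp]
  exact integral_congr_ae (hf.coeFn_toLp.mono fun x hx => congrArg (e k x • ·) hx)

theorem coeFn_sum_repr_smul (he : IsCompleteOrthonormalSystem e μ) (hf : MemLp f 2 μ)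
    (s : Finset ι) :
    ⇑(∑ k ∈ s, (he.hilbertBasis 𝕜).repr (hf.toLp f) k • he.hilbertBasis 𝕜 k) =ᵐ[μ]
      fun x => ∑ k ∈ s, e k x • ∫ y, e k y • f y ∂μ := by
  have hterm : ∀ k ∈ s, ∀ᵐ x ∂μ,
      ((he.hilbertBasis 𝕜).repr (hf.toLp f) k • he.hilbertBasis 𝕜 k) x =
        e k x • ∫ y, e k y • f y ∂μ := fun k _ => by
    rw [he.repr_toLp, he.hilbertBasis_apply]
    filter_upwards [Lp.coeFn_smul (∫ x, e k x • f x ∂μ) (he.toLp 𝕜 k),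
      he.coeFn_toLp (𝕜 := 𝕜) k] with x hx_smul hx
    rw [hx_smul, Pi.smul_apply, hx, RCLike.real_smul_eq_coe_mul, smul_eq_mul, mul_comm]
  filter_upwards [(ae_ball_iff s.countable_toSet).2 hterm, Lp.coeFn_fun_finsetSum s fun k =>
    (he.hilbertBasis 𝕜).repr (hf.toLp f) k • he.hilbertBasis 𝕜 k] with x hx hx_sum
  rw [hx_sum]
  exact Finset.sum_congr rfl hx

theorem tendsto_eLpNorm_sub_sum (he : IsCompleteOrthonormalSystem e μ) (hf : MemLp f 2 μ) :
    Tendsto (fun s : Finset ι => eLpNorm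
      (f - fun x => ∑ k ∈ s, e k x • ∫ y, e k y • f y ∂μ) 2 μ) atTop (𝓝 0) := by
  have hsum := (he.hilbertBasis 𝕜).hasSum_repr (hf.toLp f)
  refine ((Lp.tendsto_Lp_iff_tendsto_eLpNorm' _ _).1 hsum).congr fun s => ?_
  rw [eLpNorm_sub_comm]
  exact eLpNorm_congr_ae (hf.coeFn_toLp.sub (he.coeFn_sum_repr_smul hf s))

theorem hasSum_norm_integral_smul_sq (he : IsCompleteOrthonormalSystem e μ)
    (hf : MemLp f 2 μ) :
    HasSum (fun k => ‖∫ x, e k x • f x ∂μ‖ ^ 2) ((eLpNorm f 2 μ).toReal ^ 2) := by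
  have hparseval := lp.hasSum_norm (p := 2) (by norm_num) ((he.hilbertBasis 𝕜).repr (hf.toLp f))
  simpa [he.repr_toLp, Lp.norm_toLp] using hparseval

theorem tendsto_eLpNorm_sub_of_tendsto_integral_smul {β : Type*} {l : Filter β}
    (he : IsCompleteOrthonormalSystem e μ) (hf : MemLp f 2 μ) {g : β → X → 𝕜}
    (hg : ∀ᶠ t in l, MemLp (g t) 2 μ)
    (hle : ∀ᶠ t in l, ∀ k, ‖∫ x, e k x • g t x ∂μ‖ ≤ ‖∫ x, e k x • f x ∂μ‖)
    (hlim : ∀ k, Tendsto (fun t => ∫ x, e k x • g t x ∂μ) l (𝓝 (∫ x, e k x • f x ∂μ))) :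
    Tendsto (fun t => eLpNorm (g t - f) 2 μ) l (𝓝 0) := by
  have hsq : Tendsto (fun t => ∑' k, ‖∫ x, e k x • g t x ∂μ - ∫ x, e k x • f x ∂μ‖ ^ 2) l
      (𝓝 (∑' _ : ι, 0)) := by
    refine tendsto_tsum_of_dominated_convergence
      ((he.hasSum_norm_integral_smul_sq hf).summable.mul_left 4) (fun k => ?_) ?_
    · simpa using (((hlim k).sub_const (∫ x, e k x • f x ∂μ)).norm).pow 2
    · filter_upwards [hle] with t ht k
      rw [norm_pow, norm_norm]
      calc ‖∫ x, e k x • g t x ∂μ - ∫ x, e k x • f x ∂μ‖ ^ 2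
          ≤ (2 * ‖∫ x, e k x • f x ∂μ‖) ^ 2 := by
            gcongr
            linarith [ht k, norm_sub_le (∫ x, e k x • g t x ∂μ) (∫ x, e k x • f x ∂μ)]
        _ = 4 * ‖∫ x, e k x • f x ∂μ‖ ^ 2 := by ring
  have hnorm := ENNReal.tendsto_ofReal hsq.sqrt
  rw [tsum_zero, Real.sqrt_zero, ENNReal.ofReal_zero] at hnorm
  refine hnorm.congr' (hg.mono fun t ht => ?_)
  have hpars := he.hasSum_norm_integral_smul_sq (ht.sub hf)
  simp only [Pi.sub_apply, smul_sub,
    integral_sub (he.integrable_smul ht _) (he.integrable_smul hf _)] at hpars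
  rw [hpars.tsum_eq, Real.sqrt_sq ENNReal.toReal_nonneg, ENNReal.ofReal_toReal (ht.sub hf).2.ne]

end IsCompleteOrthonormalSystem

end OrthonormalSystem

section SpectralKernel

variable {X ι : Type*} [MeasurableSpace X] [DecidableEq ι]

/-- `K t` is the kernel of `exp(-tL)`, where `L` is the nonnegative operator with eigenvalues
`ev k` and eigenfunctions `e k`: pointwise, `K t x y = ∑ k, exp(-t ev k) e k x e k y`. -/
structure IsSpectralHeatKernel (K : ℝ → X → X → ℝ) (e : ι → X → ℝ) (ev : ι → ℝ) : Prop where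
  eigenvalue_nonneg : ∀ k, 0 ≤ ev k
  summable : ∀ t, 0 < t → ∀ x, Summable fun k => Real.exp (-t * ev k) * e k x
  hasSum : ∀ t, 0 < t → ∀ x y,
    HasSum (fun k => Real.exp (-t * ev k) * (e k x * e k y)) (K t x y)

namespace IsSpectralHeatKernel

variable {μ : Measure X} {K : ℝ → X → X → ℝ} {e : ι → X → ℝ} {ev : ι → ℝ} {𝕜 : Type*} [RCLike 𝕜]
  {f : X → 𝕜} {s t C : ℝ}

variable [Countable ι]

theorem hasSum_integral_smul (hKe : IsSpectralHeatKernel K e ev) (he : IsOrthonormalSystem e μ)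
    (ht : 0 < t) (hf : MemLp f 2 μ) (x : X) :
    HasSum (fun k => (Real.exp (-t * ev k) * e k x) • ∫ y, e k y • f y ∂μ)
      (∫ y, K t x y • f y ∂μ) :=
  he.hasSum_smul_integral (hKe.summable t ht x)
    (.of_forall fun y => by simpa only [mul_assoc] using hKe.hasSum t ht x y) hf

theorem integral_mul_eigenfunction (hKe : IsSpectralHeatKernel K e ev)
    (he : IsOrthonormalSystem e μ) (ht : 0 < t) (x : X) (k : ι) :
    ∫ y, K t x y * e k y ∂μ = Real.exp (-t * ev k) * e k x := by
  refine (hKe.hasSum_integral_smul he ht (he.memLp k) x).unique ?_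
  simp only [smul_eq_mul, he.integral_mul, mul_ite, mul_one, mul_zero]
  exact (hasSum_ite_eq k (Real.exp (-t * ev k) * e k x)).congr_fun fun j =>
    if_ctx_congr Iff.rfl (fun hj => by rw [hj]) fun _ => rfl

theorem integral_mul_kernel (hKe : IsSpectralHeatKernel K e ev) (he : IsOrthonormalSystem e μ)
    (hK : ∀ t, 0 < t → IsSymmetricKernel (K t) μ C) (hs : 0 < s) (ht : 0 < t) (x y : X) :
    ∫ z, K s x z * K t z y ∂μ = K (s + t) x y := by
  have hmem : MemLp (fun z => K t z y) 2 μ := by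
    simp only [(hK t ht).symm _ y]
    refine (memLp_two_iff_integrable_sq
      (hK t ht).measurable.of_uncurry_left.aestronglyMeasurable).2 ?_
    simpa only [pow_two, (hK t ht).symm _ y] using (hK t ht).integrable_mul_right (hK t ht) y y
  have hterm : ∀ k, ∫ z, e k z * K t z y ∂μ = Real.exp (-t * ev k) * e k y := fun k => by
    simpa only [mul_comm, (hK t ht).symm y] using hKe.integral_mul_eigenfunction he ht y k
  refine (hKe.hasSum_integral_smul he hs hmem x).unique ?_
  refine (hKe.hasSum (s + t) (add_pos hs ht) x y).congr_fun fun k => ?_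
  simp only [smul_eq_mul, hterm, neg_add, add_mul, Real.exp_add]
  ring

variable [SFinite μ]

theorem integral_eigenfunction_smul_integral (hKe : IsSpectralHeatKernel K e ev)
    (he : IsOrthonormalSystem e μ) (hK : ∀ t, 0 < t → IsSymmetricKernel (K t) μ C) (ht : 0 < t)
    (hf : MemLp f 2 μ) (k : ι) :
    ∫ x, e k x • ∫ y, K t x y • f y ∂μ ∂μ =
      Real.exp (-t * ev k) • ∫ x, e k x • f x ∂μ := by
  have hstar : ∀ x, star (∫ y, K t x y • (e k y : 𝕜) ∂μ) =
      ((Real.exp (-t * ev k) * e k x : ℝ) : 𝕜) := fun x => by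
    simp only [RCLike.real_smul_eq_coe_mul, ← RCLike.ofReal_mul, integral_ofReal,
      hKe.integral_mul_eigenfunction he ht, RCLike.star_def, RCLike.conj_ofReal]
  have hadj := (hK t ht).integral_integral_smul_mul_star hf ((he.memLp k).ofReal (K := 𝕜))
  simp only [hstar, RCLike.star_def, RCLike.conj_ofReal] at hadj
  calc ∫ x, e k x • ∫ y, K t x y • f y ∂μ ∂μ
      = ∫ x, (∫ y, K t x y • f y ∂μ) * (e k x : 𝕜) ∂μ := by
        simp only [RCLike.real_smul_eq_coe_mul, mul_comm]
    _ = ∫ x, f x * ((Real.exp (-t * ev k) * e k x : ℝ) : 𝕜) ∂μ := hadj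
    _ = Real.exp (-t * ev k) • ∫ x, e k x • f x ∂μ := by
        rw [← integral_smul]
        refine integral_congr_ae (.of_forall fun x => ?_)
        simp only [RCLike.real_smul_eq_coe_mul, RCLike.ofReal_mul]
        ring

theorem integral_eigenfunction_smul_kernelSemigroup (hKe : IsSpectralHeatKernel K e ev)
    (he : IsOrthonormalSystem e μ) (hK : ∀ t, 0 < t → IsSymmetricKernel (K t) μ C) (ht : 0 ≤ t)
    (hf : MemLp f 2 μ) (k : ι) :
    ∫ x, e k x • kernelSemigroup 𝕜 K μ t f x ∂μ =
      Real.exp (-t * ev k) • ∫ x, e k x • f x ∂μ := by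
  rcases ht.eq_or_lt with rfl | ht
  · rw [kernelSemigroup_zero, neg_zero, zero_mul, Real.exp_zero, one_smul]
  · rw [kernelSemigroup_of_pos ht]
    exact hKe.integral_eigenfunction_smul_integral he hK ht hf k

theorem tendsto_eLpNorm_kernelSemigroup_sub_sum (hKe : IsSpectralHeatKernel K e ev)
    (he : IsCompleteOrthonormalSystem e μ) (hK : ∀ t, 0 < t → IsSymmetricKernel (K t) μ C)
    (ht : 0 ≤ t) (hf : MemLp f 2 μ) :
    Tendsto (fun s : Finset ι => eLpNorm (kernelSemigroup 𝕜 K μ t f - fun x =>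
      ∑ k ∈ s, (Real.exp (-t * ev k) * e k x) • ∫ y, e k y • f y ∂μ) 2 μ) atTop (𝓝 0) := by
  have hsum := he.tendsto_eLpNorm_sub_sum (memLp_kernelSemigroup hK ht one_le_two hf)
  simpa only [hKe.integral_eigenfunction_smul_kernelSemigroup he.toIsOrthonormalSystem hK ht hf,
    smul_smul, mul_comm (e _ _)] using hsum

theorem tendsto_eLpNorm_kernelSemigroup_sub_self (hKe : IsSpectralHeatKernel K e ev)
    (he : IsCompleteOrthonormalSystem e μ) (hK : ∀ t, 0 < t → IsSymmetricKernel (K t) μ C)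
    (hf : MemLp f 2 μ) :
    Tendsto (fun t => eLpNorm (kernelSemigroup 𝕜 K μ t f - f) 2 μ) (𝓝[>] 0) (𝓝 0) := by
  have hcoeff : ∀ᶠ t in 𝓝[>] (0 : ℝ), ∀ k, ∫ x, e k x • kernelSemigroup 𝕜 K μ t f x ∂μ =
      Real.exp (-t * ev k) • ∫ x, e k x • f x ∂μ :=
    eventually_mem_nhdsWithin.mono fun t ht =>
      hKe.integral_eigenfunction_smul_kernelSemigroup he.toIsOrthonormalSystem hK ht.le hf
  refine he.tendsto_eLpNorm_sub_of_tendsto_integral_smul hf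
    (eventually_mem_nhdsWithin.mono fun t ht => memLp_kernelSemigroup hK ht.le one_le_two hf) ?_
    fun k => ?_
  · filter_upwards [hcoeff, self_mem_nhdsWithin] with t hcoeff_t ht k
    rw [hcoeff_t, norm_smul, Real.norm_of_nonneg (Real.exp_nonneg _)]
    refine mul_le_of_le_one_left (norm_nonneg _) (Real.exp_le_one_iff.2 ?_)
    exact mul_nonpos_of_nonpos_of_nonneg (neg_nonpos.2 ht.le) (hKe.eigenvalue_nonneg k)
  · have hexp : Tendsto (fun t : ℝ => Real.exp (-t * ev k)) (𝓝[>] 0) (𝓝 1) := by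
      have hcont : Continuous fun t : ℝ => Real.exp (-t * ev k) := by fun_prop
      simpa using (hcont.tendsto 0).mono_left nhdsWithin_le_nhds
    have hlim := hexp.smul_const (∫ x, e k x • f x ∂μ)
    rw [one_smul] at hlim
    exact hlim.congr' (hcoeff.mono fun t ht => (ht k).symm)

end IsSpectralHeatKernel

end SpectralKernel

theorem hasSum_fin_prod {d : ℕ} {f : Fin d → ℕ → ℝ} {a : Fin d → ℝ}
    (hf : ∀ i, HasSum (f i) (a i)) :
    HasSum (fun k : Fin d → ℕ => ∏ i, f i (k i)) (∏ i, a i) := by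
  induction d with
  | zero => simpa only [Finset.univ_eq_empty, Finset.prod_empty] using
      hasSum_unique fun _ : Fin 0 → ℕ => (1 : ℝ)
  | succ d ih =>
    rw [← (Fin.consEquiv fun _ => ℕ).hasSum_iff, Fin.prod_univ_succ]
    have htail := ih fun i => hf i.succ
    have hsummable := summable_mul_of_summable_norm (hf 0).summable.norm htail.summable.norm
    have hmul := (hf 0).mul htail hsummable
    simpa only [Function.comp_def, Fin.consEquiv_apply, Fin.prod_univ_succ, Fin.cons_zero,
      Fin.cons_succ] using hmul

namespace LaguerreConv

section Kernel

variable {d : ℕ} {α : Fin d → ℝ} {t : ℝ}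

theorem eigenvalue_eq_sum (α : Fin d → ℝ) (k : Fin d → ℕ) :
    eigenvalue α k = ∑ i, (4 * k i + 2 * α i + 2) := by
  simp only [eigenvalue, Finset.sum_add_distrib, ← Finset.mul_sum, Fin.sum_const, nsmul_eq_mul,
    mul_comm (d : ℝ)]

theorem eigenvalue_nonneg (hα : ∀ i, -1 < α i) (k : Fin d → ℕ) : 0 ≤ eigenvalue α k := by
  rw [eigenvalue_eq_sum]
  refine Finset.sum_nonneg fun i _ => ?_
  have := hα i
  have := (k i).cast_nonneg (α := ℝ)
  linarith

theorem exp_eigenvalue_eq_prod (α : Fin d → ℝ) (t : ℝ) (k : Fin d → ℕ) :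
    Real.exp (-t * eigenvalue α k) = ∏ i, Real.exp (-t * (4 * k i + 2 * α i + 2)) := by
  rw [← Real.exp_sum, ← Finset.mul_sum, eigenvalue_eq_sum]

theorem hasSum_prod_heatKernel1 (hα : ∀ i, -1 < α i) (ht : 0 < t) (x y : Fin d → ℝ) :
    HasSum (fun k => Real.exp (-t * eigenvalue α k) * (ell α k x * ell α k y))
      (∏ i, heatKernel1 (α i) t (x i) (y i)) := by
  refine (hasSum_fin_prod fun i => hasSum_heatKernel1 (hα i) ht (x i) (y i)).congr_fun fun k => ?_
  rw [exp_eigenvalue_eq_prod, ell, ell, ← Finset.prod_mul_distrib, ← Finset.prod_mul_distrib]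

theorem kernel_eq_prod (hα : ∀ i, -1 < α i) (ht : 0 < t) (x y : Fin d → ℝ) :
    kernel α t x y = ∏ i, heatKernel1 (α i) t (x i) (y i) :=
  (hasSum_prod_heatKernel1 hα ht x y).tsum_eq

theorem isSpectralHeatKernel_kernel (hα : ∀ i, -1 < α i) :
    IsSpectralHeatKernel (kernel α) (ell α) (eigenvalue α) where
  eigenvalue_nonneg := eigenvalue_nonneg hα
  summable t ht x := by
    refine (hasSum_fin_prod fun i =>
      (summable_exp_mul_ell1 (hα i) ht (x i)).hasSum).summable.congr fun k => ?_
    rw [exp_eigenvalue_eq_prod, ell, ← Finset.prod_mul_distrib]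
  hasSum t ht x y := by
    rw [kernel_eq_prod hα ht]
    exact hasSum_prod_heatKernel1 hα ht x y

theorem measurable_kernel (hα : ∀ i, -1 < α i) (ht : 0 < t) :
    Measurable (Function.uncurry (kernel α t)) := by
  refine measurable_of_tendsto_metrizable' atTop (fun s => ?_)
    (tendsto_pi_nhds.2 fun p => (isSpectralHeatKernel_kernel hα).hasSum t ht p.1 p.2)
  refine Finset.measurable_fun_sum s fun k _ => ?_
  have := (continuous_ell α k).measurable
  fun_prop

theorem integral_kernel (hα : ∀ i, -1 < α i) (ht : 0 < t) (x : Fin d → ℝ) :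
    ∫ y, kernel α t x y ∂measure α =
      ∏ i, Real.cosh (2 * t) ^ (-α i - 1) * Real.exp (-(x i ^ 2 * Real.tanh (2 * t)) / 2) := by
  simp only [kernel_eq_prod hα ht, measure_eq_pi]
  rw [integral_fintype_prod_eq_prod fun i s => heatKernel1 (α i) t (x i) s]
  exact Finset.prod_congr rfl fun i _ => integral_heatKernel1 (hα i) ht (x i)

theorem prod_cosh_rpow (α : Fin d → ℝ) (t : ℝ) :
    ∏ i, Real.cosh (2 * t) ^ (-α i - 1) = Real.cosh (2 * t) ^ (-(∑ i, α i + d)) := by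
  rw [← Real.rpow_sum_of_pos (Real.cosh_pos _), Finset.sum_sub_distrib, Finset.sum_neg_distrib,
    Fin.sum_const, nsmul_one, neg_add, sub_eq_add_neg]

theorem integral_kernel_le (hα : ∀ i, -1 < α i) (ht : 0 < t) (x : Fin d → ℝ) :
    ∫ y, kernel α t x y ∂measure α ≤ Real.cosh (2 * t) ^ (-(∑ i, α i + d)) := by
  rw [integral_kernel hα ht, ← prod_cosh_rpow]
  have hcosh := Real.cosh_pos (2 * t)
  have htanh : 0 ≤ Real.tanh (2 * t) := by
    rw [Real.tanh_eq_sinh_div_cosh]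
    exact div_nonneg (sinh_two_mul_pos ht).le hcosh.le
  refine Finset.prod_le_prod (fun i _ => by positivity) fun i _ => ?_
  refine mul_le_of_le_one_right (by positivity) (Real.exp_le_one_iff.2 ?_)
  have : 0 ≤ x i ^ 2 * Real.tanh (2 * t) := by positivity
  linarith

theorem isSymmetricKernel_kernel (hα : ∀ i, -1 < α i) (ht : 0 < t) :
    IsSymmetricKernel (kernel α t) (measure α) (Real.cosh (2 * t) ^ (-(∑ i, α i + d))) where
  measurable := measurable_kernel hα ht
  nonneg x y := by
    rw [kernel_eq_prod hα ht]
    exact Finset.prod_nonneg fun i _ => heatKernel1_nonneg (hα i) ht _ _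
  symm x y := by simp only [kernel, mul_comm (ell α _ x)]
  exists_le x := by
    choose M hM using fun i => exists_heatKernel1_le (hα i) ht (x i)
    refine ⟨∏ i, M i, fun y => ?_⟩
    rw [kernel_eq_prod hα ht]
    exact Finset.prod_le_prod (fun i _ => heatKernel1_nonneg (hα i) ht _ _) fun i _ => hM i (y i)
  integrable x := by
    simp only [funext (kernel_eq_prod hα ht x), measure_eq_pi]
    exact .fintype_prod fun i => integrable_heatKernel1 (hα i) ht (x i)
  integral_le := integral_kernel_le hα ht

theorem sum_add_card_eq (α : Fin d → ℝ) : ∑ i, α i + d = ∑ i, (α i + 1) := by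
  simp only [Finset.sum_add_distrib, Fin.sum_const, nsmul_one]

theorem cosh_rpow_le_one (hα : ∀ i, -1 < α i) (t : ℝ) :
    Real.cosh (2 * t) ^ (-(∑ i, α i + d)) ≤ 1 := by
  refine Real.rpow_le_one_of_one_le_of_nonpos (Real.one_le_cosh _) (neg_nonpos.2 ?_)
  rw [sum_add_card_eq]
  exact Finset.sum_nonneg fun i _ => (neg_lt_iff_pos_add.1 (hα i)).le

theorem cosh_rpow_lt_one [Nonempty (Fin d)] (hα : ∀ i, -1 < α i) (ht : 0 < t) :
    Real.cosh (2 * t) ^ (-(∑ i, α i + d)) < 1 := by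
  refine Real.rpow_lt_one_of_one_lt_of_neg (Real.one_lt_cosh.2 (by positivity)) (neg_lt_zero.2 ?_)
  rw [sum_add_card_eq]
  exact Finset.sum_pos (fun i _ => neg_lt_iff_pos_add.1 (hα i)) Finset.univ_nonempty

end Kernel

end LaguerreConv

section Moments

open scoped BoundedContinuousFunction

variable {X ι : Type*} [TopologicalSpace X] [MeasurableSpace X] [Fintype ι]

theorem integral_aeval_monomial (P : Measure X) (u : ι → X →ᵇ ℝ) (m : ι →₀ ℕ) (c : ℝ) :
    ∫ x, MvPolynomial.aeval u (MvPolynomial.monomial m c) x ∂P = c * ∫ x, ∏ i, u i x ^ m i ∂P := by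
  rw [← integral_const_mul, MvPolynomial.aeval_monomial,
    Finsupp.prod_fintype _ _ fun i => pow_zero _]
  simp [BoundedContinuousFunction.algebraMap_apply]

theorem integrable_mul_prod_pow [OpensMeasurableSpace X] {μ : Measure X} {g : X → ℝ}
    (hg : Integrable g μ) (u : ι → X →ᵇ ℝ) (m : ι → ℕ) :
    Integrable (fun x => g x * ∏ i, u i x ^ m i) μ := by
  have hbound := (∏ i, u i ^ m i).norm_coe_le_norm
  simp only [BoundedContinuousFunction.coe_prod, BoundedContinuousFunction.coe_pow,
    Finset.prod_apply, Pi.pow_apply] at hbound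
  refine hg.mul_bdd (Continuous.aestronglyMeasurable ?_) (.of_forall hbound)
  exact continuous_finsetProd _ fun i _ => (u i).continuous.pow _

variable [PolishSpace X] [BorelSpace X] {u : ι → X →ᵇ ℝ}

-- By Stone–Weierstrass, the algebra generated by the `u i` determines finite measures.
theorem measure_eq_of_integral_prod_pow_eq (hu : Function.Injective fun x i => u i x)
    {P Q : Measure X} [IsFiniteMeasure P] [IsFiniteMeasure Q]
    (hPQ : ∀ m : ι → ℕ, ∫ x, ∏ i, u i x ^ m i ∂P = ∫ x, ∏ i, u i x ^ m i ∂Q) : P = Q := by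
  let A : StarSubalgebra ℝ (X →ᵇ ℝ) :=
    { Algebra.adjoin ℝ (Set.range u) with
      star_mem' := fun {f} hf => by rwa [show star f = f from by ext; simp] }
  refine ext_of_forall_mem_subalgebra_integral_eq_of_polish (𝕜 := ℝ) (A := A) ?_ ?_
  · intro x y hxy
    obtain ⟨i, hi⟩ := Function.ne_iff.1 (hu.ne hxy)
    exact ⟨u i, ⟨_, ⟨u i, Algebra.subset_adjoin ⟨i, rfl⟩, rfl⟩, rfl⟩, hi⟩
  · intro g (hg : g ∈ Algebra.adjoin ℝ (Set.range u))
    rw [Algebra.adjoin_range_eq_range_aeval] at hg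
    obtain ⟨p, rfl⟩ := hg
    change ∫ x, MvPolynomial.aeval u p x ∂P = ∫ x, MvPolynomial.aeval u p x ∂Q
    induction p using MvPolynomial.induction_on' with
    | monomial m c => rw [integral_aeval_monomial, integral_aeval_monomial, hPQ]
    | add p q hp hq =>
      simp only [map_add, BoundedContinuousFunction.add_apply]
      rw [integral_add (BoundedContinuousFunction.integrable P _)
          (BoundedContinuousFunction.integrable P _),
        integral_add (BoundedContinuousFunction.integrable Q _)
          (BoundedContinuousFunction.integrable Q _), hp, hq]

theorem ae_eq_zero_of_integral_mul_prod_pow_eq_zero (hu : Function.Injective fun x i => u i x)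
    {μ : Measure X} [SigmaFinite μ] {ρ : X → ℝ} (hρ : Integrable ρ μ)
    (hmoment : ∀ m : ι → ℕ, ∫ x, ρ x * ∏ i, u i x ^ m i ∂μ = 0) : ρ =ᵐ[μ] 0 := by
  have := isFiniteMeasure_withDensity_ofReal hρ.2
  have := isFiniteMeasure_withDensity_ofReal hρ.neg.2
  have hdensity : μ.withDensity (fun x => ENNReal.ofReal (ρ x)) =
      μ.withDensity (fun x => ENNReal.ofReal ((-ρ) x)) := by
    refine measure_eq_of_integral_prod_pow_eq hu fun m => ?_
    rw [integral_withDensity_eq_integral_toReal_smul₀ hρ.aemeasurable.ennreal_ofReal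
        (.of_forall fun _ => ENNReal.ofReal_lt_top),
      integral_withDensity_eq_integral_toReal_smul₀ hρ.aemeasurable.neg.ennreal_ofReal
        (.of_forall fun _ => ENNReal.ofReal_lt_top)]
    simp only [ENNReal.toReal_ofReal', smul_eq_mul]
    rw [← sub_eq_zero, ← integral_sub (integrable_mul_prod_pow hρ.pos_part u m)
      (integrable_mul_prod_pow hρ.neg.pos_part u m)]
    simpa only [Pi.neg_apply, ← sub_mul, max_zero_sub_max_neg_zero_eq_self] using hmoment m
  rw [withDensity_eq_iff_of_sigmaFinite hρ.aemeasurable.ennreal_ofReal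
    hρ.aemeasurable.neg.ennreal_ofReal] at hdensity
  filter_upwards [hdensity] with x hx
  have hparts := congrArg ENNReal.toReal hx
  rw [ENNReal.toReal_ofReal', ENNReal.toReal_ofReal', Pi.neg_apply] at hparts
  rw [← max_zero_sub_max_neg_zero_eq_self (ρ x), hparts, sub_self, Pi.zero_apply]

end Moments

namespace LaguerreConv

section Completeness

open scoped BoundedContinuousFunction

variable {a : ℝ}

theorem isOrthonormalSystem_ell {d : ℕ} {α : Fin d → ℝ} (hα : ∀ i, -1 < α i) :
    IsOrthonormalSystem (ell α) (measure α) where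
  memLp := memLp_ell hα
  integral_mul := integral_ell_mul_ell hα

theorem hasSum_ell1_generating (ha : -1 < a) {w : ℝ} (hw : |w| < 1) (x : ℝ) :
    HasSum (fun n : ℕ => w ^ n / normConst n a * ell1 n a x)
      ((1 - w) ^ (-a - 1) * Real.exp (-x ^ 2 * w / (1 - w)) * Real.exp (-x ^ 2 / 2)) := by
  refine ((hasSum_laguerre_mul_pow ha hw (x ^ 2)).mul_right _).congr_fun fun n => ?_
  have := normConst_pos ha n
  rw [ell1_eq]
  field_simp

theorem inv_normConst_sq (ha : -1 < a) (n : ℕ) :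
    (normConst n a)⁻¹ ^ 2 = Real.Gamma (n + (a + 1)) / n.factorial / 2 := by
  have := gamma_pos ha n
  rw [inv_pow, pow_two, normConst_mul_self ha, ← add_assoc]
  field_simp

theorem summable_pow_div_normConst (ha : -1 < a) {w : ℝ} (hw : |w| < 1) :
    Summable fun n : ℕ => w ^ n / normConst n a := by
  have hw' : |(|w|)| < 1 := by rwa [abs_abs]
  refine .of_norm_bounded ((summable_geometric_of_abs_lt_one hw').add
    ((hasSum_gamma_mul_pow (neg_lt_iff_pos_add.1 ha) hw').summable.div_const 2)) fun n => ?_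
  have hinv : (normConst n a)⁻¹ ≤ 1 + (normConst n a)⁻¹ ^ 2 := by
    nlinarith [sq_nonneg ((normConst n a)⁻¹ - 1), inv_pos.2 (normConst_pos ha n)]
  calc ‖w ^ n / normConst n a‖ = |w| ^ n * (normConst n a)⁻¹ := by
        rw [norm_div, norm_pow, Real.norm_eq_abs, Real.norm_of_nonneg (normConst_pos ha n).le,
          div_eq_mul_inv]
    _ ≤ |w| ^ n * (1 + (normConst n a)⁻¹ ^ 2) := by gcongr
    _ = _ := by
        rw [inv_normConst_sq ha]
        ring

theorem abs_natCast_div_one_add_lt_one (m : ℕ) : |(m / (1 + m) : ℝ)| < 1 := by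
  rw [abs_of_nonneg (by positivity), div_lt_one (by positivity)]
  exact lt_one_add _

-- At `w = m / (1 + m)` the generating function is a multiple of `exp(-x²) ^ m * exp(-x² / 2)`.
theorem hasSum_ell1_gaussian (ha : -1 < a) (m : ℕ) (x : ℝ) :
    HasSum (fun n : ℕ => (m / (1 + m) : ℝ) ^ n / normConst n a * ell1 n a x)
      ((1 + m : ℝ) ^ (a + 1) * (Real.exp (-x ^ 2 / 2) * Real.exp (-x ^ 2) ^ m)) := by
  have hm : (0 : ℝ) < 1 + m := by positivity
  have hsub : 1 - (m / (1 + m) : ℝ) = (1 + m : ℝ)⁻¹ := by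
    field_simp
    ring
  have hexponent : -x ^ 2 * (m / (1 + m)) / (1 + m : ℝ)⁻¹ = m * -x ^ 2 := by field_simp
  convert! hasSum_ell1_generating ha (abs_natCast_div_one_add_lt_one m) x using 1
  rw [hsub, hexponent, Real.exp_nat_mul, Real.inv_rpow hm.le, ← Real.rpow_neg hm.le]
  ring_nf

variable {d : ℕ} {α : Fin d → ℝ}

theorem integral_gaussian_mul_eq_zero (hα : ∀ i, -1 < α i) {f : (Fin d → ℝ) → ℝ}
    (hf : MemLp f 2 (measure α)) (horth : ∀ k, ∫ x, ell α k x * f x ∂measure α = 0)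
    (m : Fin d → ℕ) :
    ∫ x, (∏ i, Real.exp (-x i ^ 2 / 2)) * f x * ∏ i, Real.exp (-x i ^ 2) ^ m i ∂measure α = 0 := by
  have hexpansion : ∀ x : Fin d → ℝ, HasSum
      (fun k => (∏ i, (m i / (1 + m i) : ℝ) ^ k i / normConst (k i) (α i)) * ell α k x)
      (∏ i, (1 + m i : ℝ) ^ (α i + 1) *
        (Real.exp (-x i ^ 2 / 2) * Real.exp (-x i ^ 2) ^ m i)) := fun x => by
    simpa only [ell, Finset.prod_mul_distrib] using
      hasSum_fin_prod fun i => hasSum_ell1_gaussian (hα i) (m i) (x i)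
  have hsummable : Summable fun k : Fin d → ℕ =>
      ∏ i, (m i / (1 + m i) : ℝ) ^ k i / normConst (k i) (α i) :=
    (hasSum_fin_prod fun i => (summable_pow_div_normConst (hα i)
      (abs_natCast_div_one_add_lt_one (m i))).hasSum).summable
  have hconst : ∏ i, (1 + m i : ℝ) ^ (α i + 1) ≠ 0 :=
    (Finset.prod_pos fun i _ => by positivity).ne'
  have hsum := (isOrthonormalSystem_ell hα).hasSum_smul_integral hsummable
    (.of_forall hexpansion) hf
  simp only [smul_eq_mul, horth, mul_zero] at hsum
  have hzero := hsum.unique hasSum_zero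
  simp only [Finset.prod_mul_distrib, mul_assoc, integral_const_mul] at hzero
  simpa only [mul_assoc, mul_comm (f _)] using (mul_eq_zero.1 hzero).resolve_left hconst

/-- A bounded injective continuous function on `ℝ` equal to `exp(-s²)` for `s ≥ 0`: it makes the
`exp(-x_i²)`, which separate the points of the orthant only, separate the points of `ℝ^d`. -/
noncomputable def gaussianEmbedding (s : ℝ) : ℝ :=
  Real.exp (-(max s 0) ^ 2) + 1 - Real.exp (-(min s 0) ^ 2)

theorem gaussianEmbedding_of_nonneg {s : ℝ} (hs : 0 ≤ s) :
    gaussianEmbedding s = Real.exp (-s ^ 2) := by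
  simp [gaussianEmbedding, hs]

theorem continuous_gaussianEmbedding : Continuous gaussianEmbedding := by
  unfold gaussianEmbedding
  fun_prop

theorem norm_gaussianEmbedding_le (s : ℝ) : ‖gaussianEmbedding s‖ ≤ 2 := by
  have hmax : Real.exp (-(max s 0) ^ 2) ≤ 1 :=
    Real.exp_le_one_iff.2 (neg_nonpos.2 (sq_nonneg _))
  have hmin : Real.exp (-(min s 0) ^ 2) ≤ 1 :=
    Real.exp_le_one_iff.2 (neg_nonpos.2 (sq_nonneg _))
  rw [gaussianEmbedding, Real.norm_eq_abs, abs_le]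
  constructor <;> linarith [Real.exp_pos (-(max s 0) ^ 2), Real.exp_pos (-(min s 0) ^ 2)]

theorem strictAnti_gaussianEmbedding : StrictAnti gaussianEmbedding := by
  have hexp : ∀ {u v : ℝ}, 0 ≤ u → u < v → Real.exp (-v ^ 2) < Real.exp (-u ^ 2) :=
    fun hu huv => Real.exp_lt_exp.2 (neg_lt_neg (pow_lt_pow_left₀ huv hu two_ne_zero))
  refine StrictAntiOn.Iic_union_Ici (a := 0) (fun s hs t ht hst => ?_) fun s hs t ht hst => ?_
  · simp only [Set.mem_Iic] at hs ht
    have := hexp (neg_nonneg.2 ht) (neg_lt_neg hst)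
    simp only [gaussianEmbedding, max_eq_right, min_eq_left, hs, ht, even_two.neg_pow] at this ⊢
    linarith
  · rw [gaussianEmbedding_of_nonneg hs, gaussianEmbedding_of_nonneg ht]
    exact hexp hs hst

/-- The `i`-th coordinate of `ℝ^d` seen through `gaussianEmbedding`, as a bounded continuous
function. -/
noncomputable def gaussianCoord (i : Fin d) : (Fin d → ℝ) →ᵇ ℝ :=
  .ofNormedAddCommGroup (fun x => gaussianEmbedding (x i))
    (continuous_gaussianEmbedding.comp (continuous_apply i)) 2
    fun x => norm_gaussianEmbedding_le (x i)

theorem injective_gaussianCoord : Function.Injective fun (x : Fin d → ℝ) i => gaussianCoord i x :=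
  fun _ _ hxy => funext fun i => strictAnti_gaussianEmbedding.injective (congrFun hxy i)

theorem gaussianCoord_of_mem_orthant {x : Fin d → ℝ} (hx : x ∈ orthant d) (i : Fin d) :
    gaussianCoord i x = Real.exp (-x i ^ 2) :=
  gaussianEmbedding_of_nonneg (hx i).le

theorem ell_zero (hα : ∀ i, -1 < α i) (x : Fin d → ℝ) :
    ell α 0 x = (∏ i, normConst 0 (α i)) * ∏ i, Real.exp (-x i ^ 2 / 2) := by
  rw [ell, ← Finset.prod_mul_distrib]
  refine Finset.prod_congr rfl fun i _ => ?_
  have hgamma : Real.Gamma (α i + 1) ≠ 0 := (Real.Gamma_pos_of_pos (by linarith [hα i])).ne'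
  simp [ell1_eq, laguerre, hgamma]

theorem integrable_gaussian_mul (hα : ∀ i, -1 < α i) {f : (Fin d → ℝ) → ℝ}
    (hf : MemLp f 2 (measure α)) :
    Integrable (fun x => (∏ i, Real.exp (-x i ^ 2 / 2)) * f x) (measure α) := by
  have hconst : (∏ i, normConst 0 (α i)) ≠ 0 :=
    (Finset.prod_pos fun i _ => normConst_pos (hα i) 0).ne'
  have hint := (isOrthonormalSystem_ell hα).integrable_smul hf 0
  simp only [ell_zero hα, smul_eq_mul, mul_assoc] at hint
  exact (integrable_const_mul_iff hconst.isUnit _).1 hint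

theorem isCompleteOrthonormalSystem_ell (hα : ∀ i, -1 < α i) :
    IsCompleteOrthonormalSystem (ell α) (measure α) where
  toIsOrthonormalSystem := isOrthonormalSystem_ell hα
  ae_eq_zero f hf horth := by
    have hzero := ae_eq_zero_of_integral_mul_prod_pow_eq_zero injective_gaussianCoord
      (integrable_gaussian_mul hα hf) fun m => by
        rw [← integral_gaussian_mul_eq_zero hα hf horth m]
        refine integral_congr_ae ?_
        filter_upwards [ae_mem_orthant α] with x hx
        simp only [gaussianCoord_of_mem_orthant hx]
    filter_upwards [hzero] with x hx
    exact (mul_eq_zero.1 hx).resolve_left (Finset.prod_pos fun i _ => Real.exp_pos _).ne'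

end Completeness

section Eigenfunctions

open Polynomial

variable {a : ℝ}

/-- The Laguerre polynomial `L_n^a` as an element of `ℝ[X]`, for the sake of differentiation. -/
noncomputable def laguerrePoly (n : ℕ) (a : ℝ) : ℝ[X] :=
  ∑ j ∈ Finset.range (n + 1), monomial j ((-1) ^ j *
    (Real.Gamma (n + a + 1) / (Real.Gamma (j + a + 1) * (n - j).factorial * j.factorial)))

theorem eval_laguerrePoly (n : ℕ) (a x : ℝ) : (laguerrePoly n a).eval x = laguerre n a x := by
  rw [laguerrePoly, eval_finsetSum, laguerre]
  refine Finset.sum_congr rfl fun j _ => ?_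
  rw [eval_monomial, neg_pow x]
  ring

theorem coeff_laguerrePoly (n : ℕ) (a : ℝ) (j : ℕ) :
    (laguerrePoly n a).coeff j = if j ≤ n then (-1) ^ j *
      (Real.Gamma (n + a + 1) / (Real.Gamma (j + a + 1) * (n - j).factorial * j.factorial))
      else 0 := by
  rw [laguerrePoly, finsetSum_coeff]
  simp [coeff_monomial]

theorem coeff_laguerrePoly_succ (ha : -1 < a) (n j : ℕ) :
    (j + 1) * (j + a + 1) * (laguerrePoly n a).coeff (j + 1) =
      -(n - j) * (laguerrePoly n a).coeff j := by
  rw [coeff_laguerrePoly, coeff_laguerrePoly]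
  obtain hjn | rfl | hnj := lt_trichotomy j n
  · rw [if_pos (Nat.succ_le_of_lt hjn), if_pos hjn.le]
    obtain ⟨m, rfl⟩ := Nat.exists_eq_add_of_lt hjn
    have hgamma := (gamma_pos ha j).ne'
    have hja : (j : ℝ) + a + 1 ≠ 0 := by linarith [j.cast_nonneg (α := ℝ)]
    have hgamma_succ : Real.Gamma ((j + 1 : ℕ) + a + 1) =
        (j + a + 1) * Real.Gamma (j + a + 1) := by
      rw [← Real.Gamma_add_one hja]
      push_cast
      ring_nf
    rw [hgamma_succ, show j + m + 1 - (j + 1) = m by lia, show j + m + 1 - j = m + 1 by lia,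
      Nat.factorial_succ, Nat.factorial_succ]
    push_cast
    field_simp
    ring
  · simp
  · rw [if_neg (by lia), if_neg (by lia), mul_zero, mul_zero]

theorem laguerrePoly_ode (ha : -1 < a) (n : ℕ) :
    X * derivative (derivative (laguerrePoly n a)) +
      (C (a + 1) - X) * derivative (laguerrePoly n a) + C (n : ℝ) * laguerrePoly n a = 0 := by
  ext j
  have hcoeff := coeff_laguerrePoly_succ ha n j
  cases j with
  | zero =>
    simp only [coeff_add, mul_coeff_zero, coeff_X_zero, sub_mul, coeff_sub, coeff_C_zero,
      coeff_derivative, coeff_zero]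
    push_cast at hcoeff ⊢
    linear_combination hcoeff
  | succ j =>
    simp only [coeff_add, coeff_X_mul, sub_mul, coeff_sub, coeff_C_mul, coeff_derivative,
      coeff_zero]
    push_cast at hcoeff ⊢
    linear_combination hcoeff

theorem laguerrePoly_ode_eval (ha : -1 < a) (n : ℕ) (z : ℝ) :
    z * (derivative (derivative (laguerrePoly n a))).eval z +
      (a + 1 - z) * (derivative (laguerrePoly n a)).eval z + n * (laguerrePoly n a).eval z = 0 := by
  simpa only [eval_add, eval_mul, eval_sub, eval_X, eval_C, eval_zero] using
    congrArg (eval z) (laguerrePoly_ode ha n)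

theorem hasDerivAt_eval_sq_mul_gaussian (p : ℝ[X]) (x : ℝ) :
    HasDerivAt (fun x => p.eval (x ^ 2) * Real.exp (-x ^ 2 / 2))
      (x * (C 2 * derivative p - p).eval (x ^ 2) * Real.exp (-x ^ 2 / 2)) x := by
  have hsq : HasDerivAt (fun x : ℝ => x ^ 2) (2 * x) x := by simpa using hasDerivAt_pow 2 x
  refine (((p.hasDerivAt (x ^ 2)).comp x hsq).mul (hsq.fun_neg.div_const 2).exp).congr_deriv ?_
  simp only [Function.comp_apply, eval_sub, eval_mul, eval_C]
  ring

theorem hasDerivAt_ell1 (n : ℕ) (a x : ℝ) : HasDerivAt (ell1 n a)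
    (normConst n a * (x * ((C 2 * derivative (laguerrePoly n a) - laguerrePoly n a).eval (x ^ 2) *
      Real.exp (-x ^ 2 / 2)))) x := by
  refine (((hasDerivAt_eval_sq_mul_gaussian (laguerrePoly n a) x).const_mul
    (normConst n a)).congr_deriv (by ring)).congr_of_eventuallyEq (.of_forall fun y => ?_)
  simp only [ell1_eq, eval_laguerrePoly, mul_assoc]

theorem hasDerivAt_deriv_ell1 (n : ℕ) (a x : ℝ) : HasDerivAt (deriv (ell1 n a))
    (normConst n a * ((4 * x ^ 2 * (derivative (derivative (laguerrePoly n a))).eval (x ^ 2) +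
      (2 - 4 * x ^ 2) * (derivative (laguerrePoly n a)).eval (x ^ 2) +
      (x ^ 2 - 1) * (laguerrePoly n a).eval (x ^ 2)) * Real.exp (-x ^ 2 / 2))) x := by
  rw [funext fun y => (hasDerivAt_ell1 n a y).deriv]
  refine (((hasDerivAt_id x).mul (hasDerivAt_eval_sq_mul_gaussian
    (C 2 * derivative (laguerrePoly n a) - laguerrePoly n a) x)).const_mul
    (normConst n a)).congr_deriv ?_
  simp only [id, eval_sub, eval_mul, eval_C, derivative_sub, derivative_mul, derivative_C,
    zero_mul, zero_add]
  ring

theorem ell1_eigen (ha : -1 < a) (n : ℕ) {x : ℝ} (hx : x ≠ 0) :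
    -deriv (deriv (ell1 n a)) x + x ^ 2 * ell1 n a x - (2 * a + 1) / x * deriv (ell1 n a) x =
      (4 * n + 2 * a + 2) * ell1 n a x := by
  rw [(hasDerivAt_deriv_ell1 n a x).deriv, (hasDerivAt_ell1 n a x).deriv, ell1_eq,
    ← eval_laguerrePoly]
  simp only [eval_sub, eval_mul, eval_C]
  field_simp
  linear_combination -4 * normConst n a * laguerrePoly_ode_eval ha n (x ^ 2)

variable {d : ℕ}

theorem ell_update (α : Fin d → ℝ) (k : Fin d → ℕ) (x : Fin d → ℝ) (i : Fin d) (s : ℝ) :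
    ell α k (Function.update x i s) = ell1 (k i) (α i) s *
      ∏ j ∈ Finset.univ.erase i, ell1 (k j) (α j) (x j) := by
  rw [ell, ← Finset.mul_prod_erase _ _ (Finset.mem_univ i), Function.update_self]
  congr 1
  exact Finset.prod_congr rfl fun j hj => by rw [Function.update_of_ne (Finset.ne_of_mem_erase hj)]

theorem diffOp_ell {α : Fin d → ℝ} (hα : ∀ i, -1 < α i) (k : Fin d → ℕ) {x : Fin d → ℝ}
    (hx : x ∈ orthant d) :
    diffOp α (ell α k) x = eigenvalue α k * ell α k x := by
  have hcoord : ∀ i, -(deriv (deriv (ell1 (k i) (α i))) (x i) *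
        ∏ j ∈ Finset.univ.erase i, ell1 (k j) (α j) (x j)) + x i ^ 2 * ell α k x -
      (2 * α i + 1) / x i * (deriv (ell1 (k i) (α i)) (x i) *
        ∏ j ∈ Finset.univ.erase i, ell1 (k j) (α j) (x j)) =
      (4 * k i + 2 * α i + 2) * ell α k x := fun i => by
    have hell := ell_update α k x i (x i)
    rw [Function.update_eq_self] at hell
    rw [hell]
    linear_combination (∏ j ∈ Finset.univ.erase i, ell1 (k j) (α j) (x j)) *
      ell1_eigen (hα i) (k i) (hx i).ne'
  rw [eigenvalue_eq_sum, Finset.sum_mul, ← Finset.sum_congr rfl fun i _ => hcoord i,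
    Finset.sum_sub_distrib, Finset.sum_add_distrib, Finset.sum_neg_distrib, ← Finset.sum_mul,
    diffOp]
  simp only [ell_update, iteratedDeriv_succ, iteratedDeriv_zero, deriv_mul_const_field']

end Eigenfunctions

section Semigroup

variable {d : ℕ} {α : Fin d → ℝ} {t : ℝ} {𝕜 : Type*} [RCLike 𝕜]

theorem isSymmetricKernel_kernel_one (hα : ∀ i, -1 < α i) (t : ℝ) (ht : 0 < t) :
    IsSymmetricKernel (kernel α t) (measure α) 1 :=
  (isSymmetricKernel_kernel hα ht).mono (cosh_rpow_le_one hα t)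

theorem isHeatSemigroup_semigroup (hα : ∀ i, -1 < α i) : IsHeatSemigroup α (semigroup 𝕜 α) where
  eigen k _ hx := diffOp_ell hα k hx
  memLp := memLp_ell hα
  orthonormal := integral_ell_mul_ell hα
  zero f _ := (kernelSemigroup_zero (kernel α) (measure α) f).eventuallyEq
  hasSum _ ht _ hf := (isSpectralHeatKernel_kernel hα).tendsto_eLpNorm_kernelSemigroup_sub_sum
    (isCompleteOrthonormalSystem_ell hα) (isSymmetricKernel_kernel_one hα) ht hf

theorem isSubmarkovianSemigroup_semigroup (hα : ∀ i, -1 < α i) :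
    IsSubmarkovianSemigroup (semigroup 𝕜 α) (measure α) :=
  have hspectral := isSpectralHeatKernel_kernel hα
  have hbasis := isCompleteOrthonormalSystem_ell hα
  have hkernel := isSymmetricKernel_kernel_one hα
  isSubmarkovianSemigroup_kernelSemigroup hkernel
    (fun _ _ => hspectral.integral_mul_kernel hbasis.toIsOrthonormalSystem hkernel)
    fun _ hf => hspectral.tendsto_eLpNorm_kernelSemigroup_sub_self hbasis hkernel hf

theorem lpOpNorm_semigroup_le (hα : ∀ i, -1 < α i) (ht : 0 < t) {p : ℝ≥0∞} (hp : 1 ≤ p) :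
    lpOpNorm (semigroup 𝕜 α t) p (measure α) ≤
      ENNReal.ofReal (Real.cosh (2 * t) ^ (-(∑ i, α i + d))) :=
  lpOpNorm_kernelSemigroup_le (isSymmetricKernel_kernel hα ht) ht hp

theorem semigroup_one (hα : ∀ i, -1 < α i) (ht : 0 < t) (x : Fin d → ℝ) :
    semigroup 𝕜 α t (fun _ => 1) x = ((∏ i, Real.cosh (2 * t) ^ (-α i - 1) *
      Real.exp (-(x i ^ 2 * Real.tanh (2 * t)) / 2) : ℝ) : 𝕜) := by
  rw [← integral_kernel hα ht]
  exact kernelSemigroup_one ht x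

theorem measure_ne_zero (hα : ∀ i, -1 < α i) : measure α ≠ 0 := fun hzero => by
  simpa [hzero] using integral_ell_mul_ell hα 0 0

theorem not_isMarkovianSemigroup_semigroup [Nonempty (Fin d)] (hα : ∀ i, -1 < α i) :
    ¬ IsMarkovianSemigroup (semigroup 𝕜 α) (measure α) := fun hmarkov => by
  have : NeZero (measure α) := ⟨measure_ne_zero hα⟩
  obtain ⟨x, hx⟩ := (hmarkov.conservative 1 zero_le_one).exists
  rw [semigroup_one hα one_pos, ← integral_kernel hα one_pos, ← RCLike.ofReal_one (K := 𝕜)] at hx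
  exact ((integral_kernel_le hα one_pos x).trans_lt (cosh_rpow_lt_one hα one_pos)).ne
    (RCLike.ofReal_injective hx)

end Semigroup

end LaguerreConv

theorem mainTheorem3 (𝕜 : Type*) [RCLike 𝕜] :
    (∀ (d : ℕ) (_ : 1 ≤ d) (α : Fin d → ℝ) (_ : ∀ i, -1 < α i),
      -- the heat kernel and the integral operators are well defined for `t > 0`
      (∀ t : ℝ, 0 < t →
        (∀ x ∈ LaguerreConv.orthant d, ∀ y ∈ LaguerreConv.orthant d,
          Summable (fun k : Fin d → ℕ => Real.exp (-t * LaguerreConv.eigenvalue α k) *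
            (LaguerreConv.ell α k x * LaguerreConv.ell α k y))) ∧
        ∀ f : (Fin d → ℝ) → 𝕜, MemL1AddLinfty f (LaguerreConv.measure α) →
          ∀ x ∈ LaguerreConv.orthant d,
            Integrable (fun y => LaguerreConv.kernel α t x y • f y) (LaguerreConv.measure α)) ∧
      -- on `L²` they are the operators `exp(-tL)`
      LaguerreConv.IsHeatSemigroup α (LaguerreConv.semigroup 𝕜 α) ∧
      IsSubmarkovianSemigroup (LaguerreConv.semigroup 𝕜 α) (LaguerreConv.measure α) ∧
      ¬ IsMarkovianSemigroup (LaguerreConv.semigroup 𝕜 α) (LaguerreConv.measure α) ∧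
      ∀ p : ℝ≥0∞, 1 ≤ p → ∀ t : ℝ, 0 < t →
        lpOpNorm (LaguerreConv.semigroup 𝕜 α t) p (LaguerreConv.measure α) ≤
          ENNReal.ofReal (Real.cosh (2 * t) ^ (-(∑ i, α i + d)))) ∧
    ∀ a : ℝ, -1 < a → ∀ t : ℝ, 0 < t → ∀ x : ℝ, 0 < x →
      LaguerreConv.semigroup 𝕜 (fun _ : Fin 1 => a) t (fun _ => 1) (fun _ => x) =
        ((Real.cosh (2 * t) ^ (-a - 1) * Real.exp (-(x ^ 2 * Real.tanh (2 * t)) / 2) : ℝ) : 𝕜) := by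
  refine ⟨fun d hd α hα => ⟨fun t ht => ⟨fun x _ y _ => ?_, fun f hf x _ => ?_⟩, ?_, ?_, ?_,
    fun p hp t ht => ?_⟩, fun a ha t ht x _ => ?_⟩
  · exact ((LaguerreConv.isSpectralHeatKernel_kernel hα).hasSum t ht x y).summable
  · exact (LaguerreConv.isSymmetricKernel_kernel hα ht).integrable_smul hf x
  · exact LaguerreConv.isHeatSemigroup_semigroup hα
  · exact LaguerreConv.isSubmarkovianSemigroup_semigroup hα
  · have : Nonempty (Fin d) := ⟨⟨0, hd⟩⟩
    exact LaguerreConv.not_isMarkovianSemigroup_semigroup hα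
  · exact LaguerreConv.lpOpNorm_semigroup_le hα ht hp
  · rw [LaguerreConv.semigroup_one (fun _ => ha) ht, Fin.prod_univ_one]
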